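/- For $\alpha\in(0,1)$ irrational let $R(x)=x+\alpha \pmod 1$ be the rotation on $[0,1)$, let $\lambda$ be Lebesgue measure on $[0,1)$, and let $f(x)=1/x$ for $x\in(0,1)$, $f(0)=0$. Write $S_N(f)(x)=\sum_{n=0}^{N-1} f(R^n x)$, and for integers $0\le K\le N$ let $$S_N^K(f)(x)=\sum_{n=0}^{N-1} f(R^n x)-\max_{0\le n_1<\dots<n_K\le N-1}\ \sum_{j=1}^{K} f(R^{n_j}x)$$ be the trimmed sum, with $S_N^K(f)=0$ if $K>N$. Call $\alpha$ of Roth type if the denominators $q_n$ of its continued fraction convergents satisfy: for every $\epsilon>0$, $q_{n+1}<q_n^{1+\epsilon}$ for all sufficiently large $n$. **Theorem.** There is an irrational $\alpha\in(0,1)$ of Roth type such that $$\lambda\left(\left|\frac{S_N(f)}{N\log N}-1\right|>\epsilon\right)\to 0\quad (N\to\infty)\qquad\text{for all }\epsilon>0,$$ but, for every integer $K\ge 1$ and $\lambda$-almost every $x$, $$\limsup_{N\to\infty}\frac{S_N^K(f)(x)}{N\log N}>1\ge \liminf_{N\to\infty}\frac{S_N^K(f)(x)}{N\log N}$$ (the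 $\limsup$ may be $+\infty$). In particular, for this $\alpha$ no trimmed strong law with a constant trimming sequence holds: for every integer $K\ge 0$ and all $d_N>0$ ($N\ge1$), it is not true that $S_N^K(f)(x)/d_N\to 1$ for $\lambda$-almost every $x$. -/

import Mathlib

open Filter Topology MeasureTheory

noncomputable section

/-- The trimmed Birkhoff sum `S_N^k(f)(x)`: the sum of `f (T^n x)` over `0 ≤ n ≤ N - 1`, minus the
largest total of `k` of these terms (with distinct indices); it is `0` if `k > N`. -/
def trimmedSum {X : Type*} (T : X → X) (f : X → ℝ) (k N : ℕ) (x : X) : ℝ :=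
  if h : k ≤ N then
    birkhoffSum T f N x -
      ((Finset.range N).powersetCard k).sup'
        (Finset.powersetCard_nonempty.mpr (by simpa using h))
        (fun s => ∑ n ∈ s, f (T^[n] x))
  else 0

/-- The rotation by `α`, that is `x ↦ x + α (mod 1)`, with values in `[0, 1)`. -/
def rotationMap (α : ℝ) (x : ℝ) : ℝ := Int.fract (x + α)

/-- Lebesgue measure on `[0, 1)`. -/
def unitMeasure : Measure ℝ := volume.restrict (Set.Ico 0 1)

/-- The function `1 / x`, with value `0` at `0`. -/
def recip (x : ℝ) : ℝ := 1 / x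

/-- `α` is of Roth type: for every `ε > 0`, the denominators of the continued fraction convergents
of `α` satisfy `q_{n+1} < q_n ^ (1 + ε)` for all large `n`. -/
def IsRothType (α : ℝ) : Prop :=
  ∀ ε : ℝ, 0 < ε → ∀ᶠ n : ℕ in atTop,
    (GenContFract.of α).dens (n + 1) < (GenContFract.of α).dens n ^ (1 + ε)

end

/-! The number α is built from a continued fraction with subtractions. Its approximants p_n/q_n
(`rothNum n / rothDen n`) increase to α, so q_n α - p_n is positive for every n and lies between
1/q_{n+1} and 2/q_{n+1}. The ratio q_{n+1}/q_n is about n^2. This is small enough for α to be of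
Roth type and for log q_n ≤ 2n log(n+2), yet it exceeds every constant multiple of log q_n.

Since the error is positive, a stretch of orbit of length b q_n is a rational rotation by p_n/q_n
drifting slowly to the right. If q_n x has fractional part θ and the total drift keeps θ + b q_n
(q_n α - p_n) ≤ η, then in each of the b periods the orbit comes within η/q_n of 0 from the right,
and the sum is at least b times the sum of q_n/(k+η) over k < q_n (`le_birkhoffSum_of_fract_le`).

With b = 1 and η = 2 this bounds the trimmed sums below by (1-o(1)) N log N along every orbit
avoiding 0 (`eventually_le_trimmedSum`). With η = 1/log q_n and b of order q_{n+1}/(q_n log q_n),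
the b close approaches contribute a second N log N. As b tends to infinity, deleting K terms cannot
destroy it, and the trimmed sum exceeds (3/2) N log N (`eventually_exists_le_trimmedSum`). The start
θ < 1/(2 log q_n) that this needs has probability 1/(2 log q_n), which is not summable. These events
are nearly independent, so almost every x lies in infinitely many (`ae_frequently_fract_lt`).

For the weak law, the sum truncated at N log N has mean at most about N log N, which matches the
pointwise lower bound. Markov's inequality applied to the difference gives the upper bound in
measure. It passes to trimmed sums, gives liminf ≤ 1 along an a.e. convergent subsequence, and
forces d_N ~ N log N in any strong law, contradicting the oscillation. -/

/-! ### Arithmetic of the subtractive continued fraction. -/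

/-- The partial quotients are `rothCoeff n + 2`. -/
def rothCoeff (n : ℕ) : ℕ := (n + 2) ^ 2

/-- The pairs `(u n, u n - u (n - 1))` of the continued fraction recursion
`u (n + 1) = (rothCoeff n + 2) * u n - u (n - 1)` with subtractions. -/
def rothPair (u v : ℕ) : ℕ → ℕ × ℕ
  | 0 => (u, v)
  | n + 1 => ((rothPair u v n).1 + (rothCoeff n * (rothPair u v n).1 + (rothPair u v n).2),
      rothCoeff n * (rothPair u v n).1 + (rothPair u v n).2)

/-- The denominators of the approximations. -/
def rothDen (n : ℕ) : ℕ := (rothPair 1 1 n).1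

/-- The differences of successive denominators. -/
def rothDenDiff (n : ℕ) : ℕ := (rothPair 1 1 n).2

/-- The numerators of the approximations. -/
def rothNum (n : ℕ) : ℕ := (rothPair 0 1 n).1

/-- The differences of successive numerators. -/
def rothNumDiff (n : ℕ) : ℕ := (rothPair 0 1 n).2

lemma rothDenDiff_succ (n : ℕ) :
    rothDenDiff (n + 1) = rothCoeff n * rothDen n + rothDenDiff n := rfl

lemma rothDen_succ (n : ℕ) : rothDen (n + 1) = rothDen n + rothDenDiff (n + 1) := rfl

lemma rothNumDiff_succ (n : ℕ) :
    rothNumDiff (n + 1) = rothCoeff n * rothNum n + rothNumDiff n := rfl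

lemma rothNum_succ (n : ℕ) : rothNum (n + 1) = rothNum n + rothNumDiff (n + 1) := rfl

lemma rothDen_zero : rothDen 0 = 1 := rfl

lemma rothDen_one : rothDen 1 = 6 := rfl

lemma rothDen_pos (n : ℕ) : 0 < rothDen n := by
  induction n with
  | zero => simp [rothDen_zero]
  | succ n ih => rw [rothDen_succ]; omega

lemma rothDenDiff_le (n : ℕ) : rothDenDiff n ≤ rothDen n := by
  cases n with
  | zero => exact le_rfl
  | succ n => rw [rothDen_succ]; omega

/-- The recursion is a product of matrices of determinant one. Storing differences instead of
previous terms keeps everything in ℕ; the coprimality and the determinant of consecutive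
approximants follow from this identity. -/
lemma rothNumDiff_mul (n : ℕ) :
    rothNumDiff n * rothDen n = rothNum n * rothDenDiff n + 1 := by
  induction n with
  | zero => rfl
  | succ n ih =>
    rw [rothDen_succ, rothNum_succ, rothDenDiff_succ, rothNumDiff_succ]
    linear_combination ih

lemma rothNum_succ_mul (n : ℕ) :
    rothNum (n + 1) * rothDen n = rothNum n * rothDen (n + 1) + 1 := by
  rw [rothDen_succ, rothNum_succ, rothDenDiff_succ, rothNumDiff_succ]
  linear_combination rothNumDiff_mul n

lemma rothDen_coprime (n : ℕ) : Nat.Coprime (rothNum n) (rothDen n) := by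
  apply Nat.isCoprime_iff_coprime.mp
  refine ⟨-rothDenDiff n, rothNumDiff n, ?_⟩
  have := rothNumDiff_mul n
  zify at this
  linear_combination this

lemma le_rothDen_succ (n : ℕ) : (rothCoeff n + 1) * rothDen n ≤ rothDen (n + 1) := by
  rw [rothDen_succ, rothDenDiff_succ]; nlinarith

lemma rothDen_succ_le (n : ℕ) : rothDen (n + 1) ≤ (rothCoeff n + 2) * rothDen n := by
  rw [rothDen_succ, rothDenDiff_succ]; nlinarith [rothDenDiff_le n]

lemma four_mul_rothDen_le (n : ℕ) : 4 * rothDen n ≤ rothDen (n + 1) := by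
  refine le_trans (Nat.mul_le_mul_right _ ?_) (le_rothDen_succ n)
  have := Nat.pow_le_pow_left (show 2 ≤ n + 2 by omega) 2
  unfold rothCoeff; omega

lemma rothDen_strictMono : StrictMono rothDen :=
  strictMono_nat_of_lt_succ fun n => by
    have := four_mul_rothDen_le n
    have := rothDen_pos n
    omega

lemma four_pow_le_rothDen (n : ℕ) : 4 ^ n ≤ rothDen n := by
  induction n with
  | zero => simp [rothDen_zero]
  | succ n ih => rw [pow_succ]; have := four_mul_rothDen_le n; omega

/-- This makes log q_n = O(n log n), which is why the close-approach events have divergent total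
probability. -/
lemma rothDen_le_pow (n : ℕ) : rothDen n ≤ (n + 2) ^ (2 * n) := by
  induction n with
  | zero => simp [rothDen_zero]
  | succ n ih =>
    have h : (n + 3) ^ 2 = (n + 2) ^ 2 + (2 * n + 5) := by ring
    calc rothDen (n + 1) ≤ (rothCoeff n + 2) * rothDen n := rothDen_succ_le n
      _ ≤ (n + 3) ^ 2 * (n + 3) ^ (2 * n) := by
        refine Nat.mul_le_mul (by unfold rothCoeff; omega)
          (ih.trans (Nat.pow_le_pow_left (by omega) _))
      _ = _ := by ring

/-! ### The angle and the quality of its approximations. -/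

/-- The rotation number. -/
noncomputable def rothAngle : ℝ := ⨆ n, (rothNum n : ℝ) / rothDen n

/-- The approximation errors. -/
noncomputable def rothErr (n : ℕ) : ℝ := rothDen n * rothAngle - rothNum n

lemma rothDen_cast_pos (n : ℕ) : (0 : ℝ) < rothDen n := by exact_mod_cast rothDen_pos n

lemma one_le_rothDen_cast (n : ℕ) : (1 : ℝ) ≤ rothDen n := by exact_mod_cast rothDen_pos n

lemma rothNum_div_succ (n : ℕ) :
    (rothNum (n + 1) : ℝ) / rothDen (n + 1) =
      rothNum n / rothDen n + 1 / (rothDen n * rothDen (n + 1)) := by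
  have h : (rothNum (n + 1) : ℝ) * rothDen n = rothNum n * rothDen (n + 1) + 1 := by
    exact_mod_cast rothNum_succ_mul n
  have h0 := rothDen_cast_pos n
  have h1 := rothDen_cast_pos (n + 1)
  field_simp
  linear_combination h

/-- These are nested intervals: the left ends move up by 1/(q_n q_{n+1}), and four-fold growth of
q_n makes the next interval short enough that the right ends do not increase. -/
lemma rothAngle_mem (n : ℕ) : rothAngle ∈ Set.Icc ((rothNum n : ℝ) / rothDen n)
    (rothNum n / rothDen n + 2 / (rothDen n * rothDen (n + 1))) := by
  have hm : Monotone fun n => (rothNum n : ℝ) / rothDen n := by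
    refine monotone_nat_of_le_succ fun n => ?_
    rw [rothNum_div_succ]
    have : (0 : ℝ) ≤ 1 / (rothDen n * rothDen (n + 1)) := by positivity
    linarith
  have ha : Antitone fun n =>
      (rothNum n : ℝ) / rothDen n + 2 / (rothDen n * rothDen (n + 1)) := by
    refine antitone_nat_of_succ_le fun n => ?_
    rw [rothNum_div_succ, add_assoc]
    have h0 := rothDen_cast_pos n
    have h1 := rothDen_cast_pos (n + 1)
    have h2 := rothDen_cast_pos (n + 2)
    have h : (4 : ℝ) * rothDen n ≤ rothDen (n + 1) := by exact_mod_cast four_mul_rothDen_le n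
    have h' : (4 : ℝ) * rothDen (n + 1) ≤ rothDen (n + 2) := by
      exact_mod_cast four_mul_rothDen_le (n + 1)
    have : (2 : ℝ) / (rothDen (n + 1) * rothDen (n + 2)) ≤ 1 / (rothDen n * rothDen (n + 1)) := by
      rw [div_le_div_iff₀ (by positivity) (by positivity)]
      nlinarith
    have e : (2 : ℝ) / (rothDen n * rothDen (n + 1)) =
      1 / (rothDen n * rothDen (n + 1)) + 1 / (rothDen n * rothDen (n + 1)) := by ring
    rw [e]
    gcongr
  have := hm.ciSup_mem_iInter_Icc_of_antitone ha fun n => by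
    have : (0 : ℝ) ≤ 2 / (rothDen n * rothDen (n + 1)) := by positivity
    simp only
    linarith
  exact Set.mem_iInter.mp this n

lemma rothErr_le (n : ℕ) : rothErr n ≤ 2 / rothDen (n + 1) := by
  have h := (rothAngle_mem n).2
  have h0 := rothDen_cast_pos n
  have h1 := rothDen_cast_pos (n + 1)
  calc rothErr n = rothDen n * (rothAngle - rothNum n / rothDen n) := by
        unfold rothErr; field_simp
    _ ≤ rothDen n * (2 / (rothDen n * rothDen (n + 1))) := by gcongr; linarith
    _ = _ := by field_simp

lemma le_rothErr (n : ℕ) : 1 / rothDen (n + 1) ≤ rothErr n := by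
  have h := (rothAngle_mem (n + 1)).1
  have h0 := rothDen_cast_pos n
  have h1 := rothDen_cast_pos (n + 1)
  rw [rothNum_div_succ] at h
  calc (1 : ℝ) / rothDen (n + 1) = rothDen n * (1 / (rothDen n * rothDen (n + 1))) := by
        field_simp
    _ ≤ rothDen n * (rothAngle - rothNum n / rothDen n) := by gcongr; linarith
    _ = rothErr n := by unfold rothErr; field_simp

lemma rothErr_pos (n : ℕ) : 0 < rothErr n :=
  lt_of_lt_of_le (by have := rothDen_cast_pos (n + 1); positivity) (le_rothErr n)

lemma rothErr_mul_le_one (n : ℕ) : rothDen n * rothErr n ≤ 1 := by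
  have h0 := rothDen_cast_pos n
  have h1 := rothDen_cast_pos (n + 1)
  have h : (4 : ℝ) * rothDen n ≤ rothDen (n + 1) := by exact_mod_cast four_mul_rothDen_le n
  calc rothDen n * rothErr n ≤ rothDen n * (2 / rothDen (n + 1)) := by gcongr; exact rothErr_le n
    _ ≤ 1 := by rw [← mul_div_assoc, div_le_one h1]; linarith

lemma rothErr_sub_le (n : ℕ) : 1 / (2 * rothDen (n + 1)) ≤ rothErr n - rothErr (n + 1) := by
  have h1 := rothDen_cast_pos (n + 1)
  have h2 := rothDen_cast_pos (n + 2)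
  have h : (4 : ℝ) * rothDen (n + 1) ≤ rothDen (n + 2) := by
    exact_mod_cast four_mul_rothDen_le (n + 1)
  have h3 : (2 : ℝ) / rothDen (n + 2) ≤ 1 / (2 * rothDen (n + 1)) := by
    rw [div_le_div_iff₀ (by positivity) (by positivity)]; linarith
  have h4 : (1 : ℝ) / rothDen (n + 1) = 1 / (2 * rothDen (n + 1)) + 1 / (2 * rothDen (n + 1)) := by
    field_simp; norm_num
  linarith [rothErr_le (n + 1), le_rothErr n]

lemma rothAngle_mem_Ioo : rothAngle ∈ Set.Ioo (0 : ℝ) 1 := by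
  have h1 := le_rothErr 0
  have h2 := rothErr_le 0
  simp only [rothErr, rothDen_zero, show rothNum 0 = 0 from rfl, zero_add, rothDen_one] at h1 h2
  norm_num at h1 h2
  constructor <;> linarith

/-- The approximations are the best ones up to a constant factor. -/
lemma le_abs_mul_rothAngle_sub {n : ℕ} {Q : ℤ} (hQ : 0 < Q) (hQn : Q < rothDen (n + 1)) (P : ℤ) :
    1 / (2 * rothDen (n + 1)) ≤ |Q * rothAngle - P| := by
  have hdet : (rothNum (n + 1) : ℤ) * rothDen n = rothNum n * rothDen (n + 1) + 1 := by
    exact_mod_cast rothNum_succ_mul n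
  have hq : (rothDen n : ℤ) ≤ rothDen (n + 1) := by
    exact_mod_cast (rothDen_strictMono (Nat.lt_succ_self n)).le
  have hq0 : (0 : ℤ) < rothDen n := by exact_mod_cast rothDen_pos n
  -- Coordinates of (Q, P) in the unimodular basis formed by the approximants n and n + 1.
  obtain ⟨u, hu⟩ : ∃ u : ℤ, u = Q * rothNum (n + 1) - P * rothDen (n + 1) := ⟨_, rfl⟩
  obtain ⟨v, hv⟩ : ∃ v : ℤ, v = P * rothDen n - Q * rothNum n := ⟨_, rfl⟩
  have hQe : Q = u * rothDen n + v * rothDen (n + 1) := by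
    rw [hu, hv]; linear_combination (-Q) * hdet
  have hPe : P = u * rothNum n + v * rothNum (n + 1) := by
    rw [hu, hv]; linear_combination (-P) * hdet
  -- The constraint 0 < Q < q_{n+1} forces v = 0 or opposite signs, with u dominating.
  have key : |v| ≤ |u| ∧ 1 ≤ |u| := by
    rcases lt_trichotomy v 0 with h | h | h
    · have hu0 : -v ≤ u := by
        by_contra hc
        push Not at hc
        rcases le_or_gt u 0 with h' | h' <;> nlinarith
      rw [abs_of_neg h, abs_of_pos (by linarith)]
      constructor <;> linarith
    · subst h
      have hu0 : 1 ≤ u := by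
        by_contra hc
        push Not at hc
        nlinarith
      rw [abs_of_pos (show 0 < u by linarith), abs_zero]
      constructor <;> linarith
    · have hu0 : u ≤ -v := by
        by_contra hc
        push Not at hc
        have : (1 - v) * rothDen n ≤ u * rothDen n := by
          apply mul_le_mul_of_nonneg_right _ hq0.le
          linarith
        nlinarith
      rw [abs_of_neg (show u < 0 by linarith), abs_of_pos h]
      constructor <;> linarith
  have key' : |(v : ℝ)| ≤ |(u : ℝ)| ∧ 1 ≤ |(u : ℝ)| := by exact_mod_cast key
  have e : (Q : ℝ) * rothAngle - P = u * rothErr n + v * rothErr (n + 1) := by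
    rw [hQe, hPe]; unfold rothErr; push_cast; ring
  have hs := rothErr_sub_le n
  have h1 := rothErr_pos (n + 1)
  have hpos : (0 : ℝ) < 1 / (2 * rothDen (n + 1)) := by
    have := rothDen_cast_pos (n + 1); positivity
  rw [e]
  calc 1 / (2 * (rothDen (n + 1) : ℝ)) ≤ 1 * (rothErr n - rothErr (n + 1)) := by rw [one_mul]; exact hs
    _ ≤ |(u : ℝ)| * (rothErr n - rothErr (n + 1)) := by
        apply mul_le_mul_of_nonneg_right key'.2; linarith
    _ ≤ |(u : ℝ)| * rothErr n - |(v : ℝ)| * rothErr (n + 1) := by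
        have := mul_le_mul_of_nonneg_right key'.1 h1.le
        linarith
    _ = |u * rothErr n| - |v * rothErr (n + 1)| := by
        rw [abs_mul, abs_mul, abs_of_pos h1, abs_of_pos (rothErr_pos n)]
    _ ≤ |u * rothErr n + v * rothErr (n + 1)| := by
        have := abs_sub_abs_le_abs_sub (u * rothErr n) (-(v * rothErr (n + 1)))
        rwa [abs_neg, sub_neg_eq_add] at this

lemma irrational_rothAngle : Irrational rothAngle := by
  rintro ⟨r, hr⟩
  have hlt : (r.den : ℤ) < rothDen (r.den + 1) := by
    have h1 := four_pow_le_rothDen (r.den + 1)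
    have h2 := (Nat.lt_pow_self (n := r.den + 1) (show 1 < 4 by norm_num))
    omega
  have h := le_abs_mul_rothAngle_sub (Q := r.den) (by exact_mod_cast r.den_pos) hlt r.num
  have hz : ((r.den : ℤ) : ℝ) * rothAngle - (r.num : ℤ) = 0 := by
    rw [← hr]
    have : (r.den : ℚ) * r = r.num := Rat.den_mul_eq_num r
    have : ((r.den : ℚ) * r : ℝ) = r.num := by exact_mod_cast this
    push_cast at this ⊢
    linarith
  rw [hz, abs_zero] at h
  have := rothDen_cast_pos (r.den + 1)
  have : (0 : ℝ) < 1 / (2 * rothDen (r.den + 1)) := by positivity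
  linarith

/-! ### Growth of the denominators and the Roth property. -/

/-- Integrality lets the regular convergents be tested against the best-approximation bound
`le_abs_mul_rothAngle_sub`. -/
lemma exists_int_eq_contsAux (x : ℝ) (n : ℕ) :
    (∃ a : ℤ, ((GenContFract.of x).contsAux n).a = a) ∧
      ∃ b : ℤ, ((GenContFract.of x).contsAux n).b = b := by
  induction n using Nat.strong_induction_on with
  | _ n ih =>
    rcases n with _ | _ | n
    · exact ⟨⟨1, by simp⟩, ⟨0, by simp⟩⟩
    · exact ⟨⟨⌊x⌋, by simp⟩, ⟨1, by simp⟩⟩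
    · rcases hs : (GenContFract.of x).s.get? n with _ | gp
      · rw [GenContFract.contsAux_stable_step_of_terminated hs]
        exact ih (n + 1) (by omega)
      · obtain ⟨h1, z, hz⟩ := GenContFract.of_partNum_eq_one_and_exists_int_partDen_eq hs
        obtain ⟨⟨a, ha⟩, b, hb⟩ := ih n (by omega)
        obtain ⟨⟨a', ha'⟩, b', hb'⟩ := ih (n + 1) (by omega)
        rw [GenContFract.contsAux_recurrence hs rfl rfl]
        refine ⟨⟨z * a' + a, ?_⟩, ⟨z * b' + b, ?_⟩⟩
        · simp [h1, hz, ha, ha']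
        · simp [h1, hz, hb, hb']

lemma exists_rothDen_le_lt {N : ℕ} (hN : 1 ≤ N) :
    ∃ n, rothDen n ≤ N ∧ N < rothDen (n + 1) := by
  have hex : ∃ n, N < rothDen (n + 1) := by
    refine ⟨N, ?_⟩
    have h1 := four_pow_le_rothDen (N + 1)
    have h2 := (Nat.lt_pow_self (n := N + 1) (show 1 < 4 by norm_num))
    omega
  classical
  refine ⟨Nat.find hex, ?_, Nat.find_spec hex⟩
  rcases h : Nat.find hex with _ | m
  · simpa [rothDen_zero] using hN
  · exact not_lt.mp (Nat.find_min hex (m := m) (by omega))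

lemma log_rothDen_ge (n : ℕ) : (n : ℝ) ≤ Real.log (rothDen n) := by
  have h4 : (1 : ℝ) ≤ Real.log 4 := by
    rw [Real.le_log_iff_exp_le (by norm_num)]
    linarith [Real.exp_one_lt_d9]
  calc (n : ℝ) ≤ n * Real.log 4 := by nlinarith [Nat.cast_nonneg (α := ℝ) n]
    _ = Real.log (4 ^ n) := by rw [Real.log_pow]
    _ ≤ _ := Real.log_le_log (by positivity) (by exact_mod_cast four_pow_le_rothDen n)

lemma log_rothDen_le (n : ℕ) : Real.log (rothDen n) ≤ 2 * n * Real.log (n + 2) := by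
  calc Real.log (rothDen n) ≤ Real.log (((n : ℝ) + 2) ^ (2 * n)) :=
        Real.log_le_log (rothDen_cast_pos n) (by exact_mod_cast rothDen_le_pow n)
    _ = _ := by rw [Real.log_pow]; push_cast; ring

lemma tendsto_log_rothDen : Tendsto (fun n => Real.log (rothDen n)) atTop atTop :=
  tendsto_atTop_mono log_rothDen_ge tendsto_natCast_atTop_atTop

lemma isLittleO_log_add_natCast (c : ℝ) :
    (fun n : ℕ => Real.log (n + c)) =o[atTop] fun n : ℕ => (n : ℝ) := by
  have h1 : (fun n : ℕ => Real.log (n + c)) =o[atTop] fun n : ℕ => (n : ℝ) + c :=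
    Real.isLittleO_log_id_atTop.comp_tendsto
      (tendsto_atTop_add_const_right _ c tendsto_natCast_atTop_atTop)
  refine h1.trans_isBigO ((Asymptotics.isBigO_refl _ _).add ?_)
  exact (Asymptotics.isLittleO_const_left.mpr (Or.inr
    (tendsto_norm_atTop_atTop.comp tendsto_natCast_atTop_atTop))).isBigO

lemma eventually_log_coeff_lt {ε : ℝ} (hε : 0 < ε) :
    ∀ᶠ n in atTop, Real.log (2 * (rothCoeff n + 2)) < ε * Real.log (rothDen n) := by
  have h := (isLittleO_log_add_natCast 3).def (show 0 < ε / 4 by positivity)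
  filter_upwards [h, eventually_gt_atTop ⌈2 / ε⌉₊] with n hn hn2
  have hn2' : 2 / ε < n := (Nat.le_ceil _).trans_lt (by exact_mod_cast hn2)
  rw [div_lt_iff₀ hε] at hn2'
  have hlog : 0 ≤ Real.log ((n : ℝ) + 3) := Real.log_nonneg (by linarith [Nat.cast_nonneg (α := ℝ) n])
  rw [Real.norm_of_nonneg hlog, Real.norm_of_nonneg (Nat.cast_nonneg n)] at hn
  have h2 : Real.log 2 < 1 := by linarith [Real.log_two_lt_d9]
  calc Real.log (2 * (rothCoeff n + 2)) ≤ Real.log (2 * ((n : ℝ) + 3) ^ 2) := by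
        apply Real.log_le_log (by positivity)
        unfold rothCoeff
        push_cast
        nlinarith [Nat.cast_nonneg (α := ℝ) n]
    _ = Real.log 2 + 2 * Real.log (n + 3) := by
        rw [Real.log_mul (by norm_num) (by positivity), Real.log_pow]; norm_num
    _ < ε * n := by nlinarith
    _ ≤ _ := by gcongr; exact log_rothDen_ge n

lemma log_rothDen_succ_le (n : ℕ) :
    Real.log (rothDen (n + 1)) ≤ Real.log (2 * (rothCoeff n + 2)) + Real.log (rothDen n) := by
  have h0 := rothDen_cast_pos n
  rw [← Real.log_mul (by positivity) h0.ne']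
  apply Real.log_le_log (rothDen_cast_pos _)
  have : (rothDen (n + 1) : ℝ) ≤ (rothCoeff n + 2) * rothDen n := by
    exact_mod_cast rothDen_succ_le n
  nlinarith [mul_nonneg (show (0 : ℝ) ≤ rothCoeff n + 2 by positivity) h0.le]

lemma eventually_log_rothDen_succ_le {ε : ℝ} (hε : 0 < ε) :
    ∀ᶠ n in atTop, Real.log (rothDen (n + 1)) ≤ (1 + ε) * Real.log (rothDen n) := by
  filter_upwards [eventually_log_coeff_lt hε] with n hn
  linarith [log_rothDen_succ_le n]

/-- The regular convergents need not be identified with p_n/q_n. If q_n ≤ D < q_{n+1} for a regular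
denominator D, then its error is at least 1/(2 q_{n+1}) and at most the inverse of the next regular
denominator. That denominator is thus at most 2 q_{n+1}, and 2 q_{n+1}/q_n is below any power of
q_n. -/
lemma isRothType_rothAngle : IsRothType rothAngle := by
  intro ε hε
  obtain ⟨n₀, hn₀⟩ := eventually_atTop.mp (eventually_log_coeff_lt hε)
  have hnt : ∀ k, ¬(GenContFract.of rothAngle).TerminatedAt k := fun k hk =>
    irrational_rothAngle (by
      obtain ⟨r, hr⟩ := (GenContFract.terminates_iff_rat rothAngle).mp ⟨k, hk⟩
      exact ⟨r, hr.symm⟩)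
  have hfib : ∀ k, (Nat.fib (k + 1) : ℝ) ≤ (GenContFract.of rothAngle).dens k := fun k =>
    GenContFract.succ_nth_fib_le_of_nth_den (Or.inr (hnt _))
  filter_upwards [eventually_ge_atTop (rothDen n₀ + 5)] with k hk
  obtain ⟨⟨A, hA⟩, D, hD⟩ := exists_int_eq_contsAux rothAngle (k + 1)
  have hd : (GenContFract.of rothAngle).dens k = D := hD
  have hn : (GenContFract.of rothAngle).nums k = A := hA
  have hDk : (rothDen n₀ : ℝ) ≤ D := by
    rw [← hd]
    refine le_trans ?_ (hfib k)
    have := Nat.le_fib_self (n := k + 1) (by omega)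
    exact_mod_cast (by omega : rothDen n₀ ≤ Nat.fib (k + 1))
  have hD0 : (0 : ℝ) < D := (rothDen_cast_pos n₀).trans_le hDk
  have hd' : 0 < (GenContFract.of rothAngle).dens (k + 1) :=
    lt_of_lt_of_le (by exact_mod_cast Nat.fib_pos.mpr (by omega)) (hfib (k + 1))
  lift D to ℕ using (by exact_mod_cast hD0.le)
  rw [Int.cast_natCast] at hd hD0 hDk
  obtain ⟨n, hn1, hn2⟩ := exists_rothDen_le_lt (N := D) (by exact_mod_cast hD0)
  have hnn : n₀ ≤ n := by
    by_contra hc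
    have h1 : rothDen (n + 1) ≤ rothDen n₀ := rothDen_strictMono.monotone (by omega)
    have h2 : rothDen n₀ ≤ D := by exact_mod_cast hDk
    omega
  have happ := GenContFract.abs_sub_convs_le (hnt k)
  rw [GenContFract.conv_eq_num_div_den, hn, hd] at happ
  have happ' : |(D : ℝ) * rothAngle - A| ≤ 1 / (GenContFract.of rothAngle).dens (k + 1) := by
    calc |(D : ℝ) * rothAngle - A| = D * |rothAngle - A / D| := by
          rw [← abs_of_pos hD0, ← abs_mul, abs_of_pos hD0]; congr 1; field_simp
      _ ≤ D * (1 / (D * (GenContFract.of rothAngle).dens (k + 1))) := by gcongr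
      _ = _ := by field_simp
  have hlow := le_abs_mul_rothAngle_sub (n := n) (Q := D) (by exact_mod_cast hD0)
    (by exact_mod_cast hn2) A
  rw [Int.cast_natCast] at hlow
  have h3 := hlow.trans happ'
  have hq1 := rothDen_cast_pos (n + 1)
  have hq0 := rothDen_cast_pos n
  rw [one_div_le_one_div (by positivity) hd'] at h3
  have h4 : (rothDen (n + 1) : ℝ) ≤ (rothCoeff n + 2) * rothDen n := by
    exact_mod_cast rothDen_succ_le n
  have h5 : (2 * (rothCoeff n + 2) : ℝ) < (rothDen n : ℝ) ^ ε := by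
    rw [← Real.log_lt_log_iff (by positivity) (by positivity), Real.log_rpow hq0]
    exact hn₀ n hnn
  have h6 : (rothDen n : ℝ) ≤ D := by exact_mod_cast hn1
  rw [hd]
  calc (GenContFract.of rothAngle).dens (k + 1) ≤ 2 * rothDen (n + 1) := h3
    _ ≤ (2 * (rothCoeff n + 2)) * rothDen n := by linarith
    _ < (rothDen n : ℝ) ^ ε * rothDen n := by gcongr
    _ ≤ (D : ℝ) ^ ε * D := by gcongr
    _ = (D : ℝ) ^ (1 + ε) := by rw [Real.rpow_add hD0, Real.rpow_one, mul_comm]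

/-! ### Trimming compared with truncation. -/

section Trimmed

variable {X : Type*} (T : X → X) (f : X → ℝ)

lemma trimmedSum_zero (N : ℕ) (x : X) : trimmedSum T f 0 N x = birkhoffSum T f N x := by
  simp [trimmedSum]

/-- Whichever K terms are deleted, they account for at most K L of the sum truncated at L, and
truncation only lowers the others. -/
lemma le_trimmedSum (L : ℝ) {K N : ℕ} (hKN : K ≤ N) (x : X) :
    birkhoffSum T (fun y => min (f y) L) N x - K * L ≤ trimmedSum T f K N x := by
  classical
  rw [trimmedSum, dif_pos hKN]
  obtain ⟨s, hs, hs'⟩ := Finset.exists_mem_eq_sup' (Finset.powersetCard_nonempty.mpr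
    (by simpa using hKN : K ≤ (Finset.range N).card)) (fun s => ∑ n ∈ s, f (T^[n] x))
  rw [hs']
  obtain ⟨hsub, hcard⟩ := Finset.mem_powersetCard.mp hs
  have h1 : ∑ n ∈ s, min (f (T^[n] x)) L ≤ K * L := by
    calc ∑ n ∈ s, min (f (T^[n] x)) L ≤ ∑ _n ∈ s, L := Finset.sum_le_sum fun _ _ => min_le_right _ _
      _ = K * L := by simp [hcard]
  have h2 : ∑ n ∈ Finset.range N \ s, min (f (T^[n] x)) L ≤ ∑ n ∈ Finset.range N \ s, f (T^[n] x) :=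
    Finset.sum_le_sum fun _ _ => min_le_left _ _
  have h3 := Finset.sum_sdiff (f := fun n => min (f (T^[n] x)) L) hsub
  have h4 := Finset.sum_sdiff (f := fun n => f (T^[n] x)) hsub
  simp only [birkhoffSum]
  linarith

lemma trimmedSum_le (K N : ℕ) {x : X} (hf : ∀ n, 0 ≤ f (T^[n] x)) :
    trimmedSum T f K N x ≤ birkhoffSum T f N x := by
  rw [trimmedSum]
  split_ifs with h
  · obtain ⟨s, hs, hs'⟩ := Finset.exists_mem_eq_sup' (Finset.powersetCard_nonempty.mpr
      (by simpa using h : K ≤ (Finset.range N).card)) (fun s => ∑ n ∈ s, f (T^[n] x))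
    rw [hs']
    have : 0 ≤ ∑ n ∈ s, f (T^[n] x) := Finset.sum_nonneg fun _ _ => hf _
    linarith
  · exact Finset.sum_nonneg fun _ _ => hf _

lemma birkhoffSum_mono_right {f g : X → ℝ} {N : ℕ} {x : X} (h : ∀ n < N, f (T^[n] x) ≤ g (T^[n] x)) :
    birkhoffSum T f N x ≤ birkhoffSum T g N x :=
  Finset.sum_le_sum fun n hn => h n (Finset.mem_range.mp hn)

end Trimmed

/-! ### Rotation orbits as drifting rational rotations. -/

lemma fract_add_fract_left (a b : ℝ) : Int.fract (Int.fract a + b) = Int.fract (a + b) :=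
  Int.fract_eq_fract.mpr ⟨-⌊a⌋, by rw [Int.fract]; push_cast; ring⟩

lemma rotationMap_iterate {x : ℝ} (hx : x ∈ Set.Ico (0 : ℝ) 1) (α : ℝ) (n : ℕ) :
    (rotationMap α)^[n] x = Int.fract (x + n * α) := by
  induction n with
  | zero => simp [Int.fract_eq_self.mpr hx]
  | succ n ih =>
    rw [Function.iterate_succ_apply', ih, rotationMap, fract_add_fract_left]
    push_cast
    ring_nf

lemma rotationMap_iterate_mem {x : ℝ} (hx : x ∈ Set.Ico (0 : ℝ) 1) (α : ℝ) (n : ℕ) :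
    (rotationMap α)^[n] x ∈ Set.Ico (0 : ℝ) 1 := by
  rw [rotationMap_iterate hx]
  exact ⟨Int.fract_nonneg _, Int.fract_lt_one _⟩

/-- The forward orbit of `x` under the rotation by `α` does not meet `0`. -/
def AvoidsZero (α x : ℝ) : Prop := ∀ n : ℕ, Int.fract (x + n * α) ≠ 0

lemma AvoidsZero.iterate {α x : ℝ} (h : AvoidsZero α x) (hx : x ∈ Set.Ico (0 : ℝ) 1) (m : ℕ) :
    AvoidsZero α ((rotationMap α)^[m] x) := by
  intro n
  rw [rotationMap_iterate hx, fract_add_fract_left]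
  convert h (m + n) using 2
  push_cast
  ring

lemma recip_nonneg_of_nonneg {x : ℝ} (hx : 0 ≤ x) : 0 ≤ recip x := by unfold recip; positivity

/-- As p is invertible mod q, each period of q steps visits every residue exactly once. -/
lemma sum_range_mod {p q : ℕ} (hq : 0 < q) (hpq : Nat.Coprime p q) (m b : ℕ) (g : ℕ → ℝ) :
    ∑ s ∈ Finset.range (b * q), g ((m + s * p) % q) = b * ∑ k ∈ Finset.range q, g k := by
  have hinj : Set.InjOn (fun j => (m + j * p) % q) (Finset.range q) := by
    intro i hi j hj hij
    have h1 : i * p ≡ j * p [MOD q] := Nat.ModEq.add_left_cancel' m hij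
    have h2 : i ≡ j [MOD q] := Nat.ModEq.cancel_right_of_coprime hpq.symm h1
    simp only [Finset.coe_range, Set.mem_Iio] at hi hj
    exact Nat.ModEq.eq_of_lt_of_lt h2 hi hj
  have hmaps : Set.MapsTo (fun j => (m + j * p) % q) (Finset.range q) (Finset.range q) := fun j _ => by
    simpa using Nat.mod_lt _ hq
  have hblock : ∑ j ∈ Finset.range q, g ((m + j * p) % q) = ∑ k ∈ Finset.range q, g k :=
    Finset.sum_nbij (fun j => (m + j * p) % q) hmaps hinj
      (Finset.surjOn_of_injOn_of_card_le _ hmaps hinj le_rfl) fun _ _ => rfl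
  induction b with
  | zero => simp
  | succ b ih =>
    rw [Nat.succ_mul, Finset.sum_range_add, ih]
    have : ∀ j ∈ Finset.range q, g ((m + (b * q + j) * p) % q) = g ((m + j * p) % q) := by
      intro j _
      congr 1
      rw [show m + (b * q + j) * p = m + j * p + q * (b * p) by ring, Nat.add_mul_mod_self_left]
    rw [Finset.sum_congr rfl this, hblock]
    push_cast
    ring

lemma fract_le_of_eq_intCast_add {x y : ℝ} {z : ℤ} (h : x = z + y) (hy : 0 ≤ y) :
    Int.fract x ≤ y := by
  rw [h, Int.fract_intCast_add, Int.fract]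
  have : (0 : ℝ) ≤ ⌊y⌋ := by exact_mod_cast Int.floor_nonneg.mpr hy
  linarith

/-- Writing q x = m + θ, the s-th orbit point lies over the residue k of m + s p, at most (k + θ +
s(qα - p))/q from 0. The nonnegative drift stays below η, so the reciprocal is at least q/(k + η).
All these lower bounds are at most q/η, so truncating there costs nothing. -/
lemma le_birkhoffSum_of_fract_le {p q : ℕ} (hq : 0 < q) (hpq : Nat.Coprime p q) {α : ℝ}
    (hδ : 0 ≤ q * α - p) {x : ℝ} (hx : x ∈ Set.Ico (0 : ℝ) 1) (hx0 : AvoidsZero α x) {b : ℕ} {η : ℝ}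
    (hη : 0 < η) (hb : Int.fract (q * x) + b * q * (q * α - p) ≤ η) :
    b * ∑ k ∈ Finset.range q, q / ((k : ℝ) + η) ≤
      birkhoffSum (rotationMap α) (fun y => min (recip y) (q / η)) (b * q) x := by
  have hq' : (0 : ℝ) < q := by exact_mod_cast hq
  have hm0 : 0 ≤ ⌊q * x⌋ := Int.floor_nonneg.mpr (mul_nonneg hq'.le hx.1)
  obtain ⟨m, hm⟩ := Int.eq_ofNat_of_zero_le hm0
  have hqx : q * x = m + Int.fract (q * x) := by
    have := Int.floor_add_fract (q * x)
    rw [hm] at this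
    exact_mod_cast this.symm
  have hθ := Int.fract_nonneg (q * x)
  generalize Int.fract (q * x) = θ at hb hqx hθ
  rw [← sum_range_mod hq hpq m b (fun k => q / ((k : ℝ) + η))]
  refine Finset.sum_le_sum fun s hs => ?_
  have hs' : (s : ℝ) ≤ b * q := by exact_mod_cast (Finset.mem_range.mp hs).le
  set k := (m + s * p) % q with hk
  refine le_min ?_ (div_le_div_of_nonneg_left hq'.le hη (by linarith [Nat.cast_nonneg (α := ℝ) k]))
  have hdiv : ((m : ℝ) + s * p) = q * ((m + s * p) / q : ℕ) + k := by
    exact_mod_cast (Nat.div_add_mod (m + s * p) q).symm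
  have hsd : s * (q * α - p) ≤ b * q * (q * α - p) := mul_le_mul_of_nonneg_right hs' hδ
  have hfr : Int.fract (x + s * α) ≤ (k + (θ + s * (q * α - p))) / q := by
    refine fract_le_of_eq_intCast_add (z := ((m + s * p) / q : ℕ)) ?_ ?_
    · rw [Int.cast_natCast]
      field_simp
      linear_combination hdiv + hqx
    · positivity
  rw [rotationMap_iterate hx, recip]
  -- Avoidance of 0 is essential here: `recip 0` is 0, not infinity.
  have hpos : 0 < Int.fract (x + s * α) := lt_of_le_of_ne (Int.fract_nonneg _) (hx0 s).symm
  rw [div_le_div_iff₀ (by positivity) hpos, one_mul]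
  rw [le_div_iff₀ hq'] at hfr
  linarith

lemma log_le_sum_one_div (q : ℕ) : Real.log q ≤ ∑ k ∈ Finset.range q, 1 / ((k : ℝ) + 1) := by
  rcases Nat.eq_zero_or_pos q with rfl | hq
  · simp
  calc Real.log q ≤ Real.log (q + 1 : ℕ) :=
        Real.log_le_log (by exact_mod_cast hq) (by push_cast; linarith)
    _ ≤ (harmonic q : ℝ) := log_add_one_le_harmonic q
    _ = _ := by simp [harmonic]

lemma sum_div_add_two_ge (q : ℕ) :
    q * (Real.log q - 1) ≤ ∑ k ∈ Finset.range q, q / ((k : ℝ) + 2) := by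
  have h := log_le_sum_one_div (q + 1)
  rw [Finset.sum_range_succ'] at h
  have h2 : ∑ k ∈ Finset.range q, q / ((k : ℝ) + 2) =
      q * ∑ k ∈ Finset.range q, 1 / (((k + 1 : ℕ) : ℝ) + 1) := by
    rw [Finset.mul_sum]
    refine Finset.sum_congr rfl fun k _ => ?_
    push_cast
    rw [mul_one_div]
    ring_nf
  rw [h2]
  gcongr
  rcases Nat.eq_zero_or_pos q with rfl | hq
  · simp
  have : Real.log q ≤ Real.log (q + 1 : ℕ) :=
    Real.log_le_log (by exact_mod_cast hq) (by push_cast; linarith)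
  norm_num at h ⊢
  norm_num at this
  linarith

lemma sum_div_add_ge {q : ℕ} (hq : 0 < q) {η : ℝ} (hη : 0 < η) (hη1 : η ≤ 1) :
    q * (1 / η + Real.log q - 1) ≤ ∑ k ∈ Finset.range q, q / ((k : ℝ) + η) := by
  have h := log_le_sum_one_div q
  obtain ⟨r, rfl⟩ : ∃ r, q = r + 1 := ⟨q - 1, by omega⟩
  rw [Finset.sum_range_succ'] at h ⊢
  have h2 : ∑ k ∈ Finset.range r, 1 / (((k + 1 : ℕ) : ℝ) + 1) ≤
      ∑ k ∈ Finset.range r, 1 / (((k + 1 : ℕ) : ℝ) + η) := by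
    gcongr
  have h3 : ∑ k ∈ Finset.range r, ((r + 1 : ℕ) : ℝ) / (((k + 1 : ℕ) : ℝ) + η) =
      ((r + 1 : ℕ) : ℝ) * ∑ k ∈ Finset.range r, 1 / (((k + 1 : ℕ) : ℝ) + η) := by
    rw [Finset.mul_sum]
    exact Finset.sum_congr rfl fun k _ => by rw [mul_one_div]
  rw [h3, Nat.cast_zero, zero_add, show ((r + 1 : ℕ) : ℝ) / η = ((r + 1 : ℕ) : ℝ) * (1 / η) by ring,
    ← mul_add]
  gcongr
  norm_num at h ⊢
  norm_num at h2
  linarith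

lemma birkhoffSum_min_recip_le {α x L : ℝ} {M N : ℕ} (hL : 0 ≤ L) (hx : x ∈ Set.Ico (0 : ℝ) 1)
    (hMN : M ≤ N) : birkhoffSum (rotationMap α) (fun y => min (recip y) L) M x ≤
      birkhoffSum (rotationMap α) (fun y => min (recip y) L) N x :=
  Finset.sum_le_sum_of_subset_of_nonneg (Finset.range_mono hMN) fun n _ _ =>
    le_min (recip_nonneg_of_nonneg (rotationMap_iterate_mem hx α n).1) hL

/-! ### Lower bounds for every orbit avoiding 0. -/

/-- Within one period both the initial fractional part and the drift are at most 1, so η = 2 works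
from any starting point; the blocks are restarted after each period. -/
lemma mul_log_le_birkhoffSum_blocks (n : ℕ) {x : ℝ} (hx : x ∈ Set.Ico (0 : ℝ) 1)
    (hx0 : AvoidsZero rothAngle x) (b : ℕ) :
    b * (rothDen n * (Real.log (rothDen n) - 1)) ≤
      birkhoffSum (rotationMap rothAngle) (fun y => min (recip y) (rothDen n))
        (b * rothDen n) x := by
  induction b with
  | zero => simp
  | succ b ih =>
    rw [Nat.succ_mul, birkhoffSum_add]
    have hx' := rotationMap_iterate_mem hx rothAngle (b * rothDen n)
    set x' := (rotationMap rothAngle)^[b * rothDen n] x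
    have h := le_birkhoffSum_of_fract_le (rothDen_pos n) (rothDen_coprime n) (rothErr_pos n).le hx'
      (hx0.iterate hx _) (b := 1) (η := 2) two_pos (by
        have h1 := (Int.fract_lt_one (rothDen n * x')).le
        have h2 := rothErr_mul_le_one n
        unfold rothErr at h2
        rw [Nat.cast_one, one_mul]
        linarith)
    rw [Nat.cast_one, one_mul, one_mul] at h
    have h2 := (sum_div_add_two_ge (rothDen n)).trans h
    have h3 : birkhoffSum (rotationMap rothAngle) (fun y => min (recip y) (rothDen n / 2))
        (rothDen n) x' ≤ birkhoffSum (rotationMap rothAngle) (fun y => min (recip y) (rothDen n))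
        (rothDen n) x' :=
      birkhoffSum_mono_right _ fun _ _ => min_le_min_left _ (by
        linarith [rothDen_cast_pos n])
    push_cast
    linarith

/-- Lower bound for truncated Birkhoff sums, valid at every point whose orbit avoids `0`. -/
lemma sub_mul_log_le_birkhoffSum {n : ℕ} (hn : 1 ≤ n) {x : ℝ} (hx : x ∈ Set.Ico (0 : ℝ) 1)
    (hx0 : AvoidsZero rothAngle x) (N : ℕ) {L : ℝ} (hL : rothDen n ≤ L) :
    (N - rothDen n) * (Real.log (rothDen n) - 1) ≤
      birkhoffSum (rotationMap rothAngle) (fun y => min (recip y) L) N x := by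
  have hq := rothDen_cast_pos n
  have h1 := mul_log_le_birkhoffSum_blocks n hx hx0 (N / rothDen n)
  have h2 : birkhoffSum (rotationMap rothAngle) (fun y => min (recip y) (rothDen n))
      (N / rothDen n * rothDen n) x ≤ birkhoffSum (rotationMap rothAngle)
      (fun y => min (recip y) L) (N / rothDen n * rothDen n) x :=
    birkhoffSum_mono_right _ fun _ _ => min_le_min_left _ hL
  have h3 := birkhoffSum_min_recip_le (α := rothAngle) (hq.le.trans hL) hx
    (Nat.div_mul_le_self N (rothDen n))
  have hlog : (1 : ℝ) ≤ Real.log (rothDen n) :=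
    le_trans (by exact_mod_cast hn) (log_rothDen_ge n)
  have h4 : (N : ℝ) - rothDen n ≤ (N / rothDen n : ℕ) * rothDen n := by
    have := Nat.div_add_mod' N (rothDen n)
    have h := Nat.mod_lt N (rothDen_pos n)
    have h' : N ≤ N / rothDen n * rothDen n + rothDen n := by omega
    have : (N : ℝ) ≤ (N / rothDen n : ℕ) * rothDen n + rothDen n := by exact_mod_cast h'
    linarith
  calc ((N : ℝ) - rothDen n) * (Real.log (rothDen n) - 1)
      ≤ ((N / rothDen n : ℕ) * rothDen n) * (Real.log (rothDen n) - 1) :=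
        mul_le_mul_of_nonneg_right h4 (by linarith)
    _ ≤ _ := by linarith

/-- The scale is chosen one level below N: with q_{n+1} ≤ N < q_{n+2}, the incomplete block and K
truncated terms, of order q_n, are negligible against N, while log q_n is still asymptotic to log N.
-/
lemma eventually_exists_rothDen_bound (K : ℕ) {ε : ℝ} (hε : 0 < ε) :
    ∀ᶠ N : ℕ in atTop, ∃ n, 1 ≤ n ∧ rothDen n ≤ N ∧
      (1 - ε) * (N * Real.log N) ≤
        (N - rothDen n) * (Real.log (rothDen n) - 1) - K * rothDen n := by
  -- The loss is 2κ from the two factors 1 - κ and Kκ from the trimmed terms.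
  obtain ⟨κ, hκ0, hκ1, hκ⟩ : ∃ κ : ℝ, 0 < κ ∧ κ ≤ 1 ∧ κ * (K + 2) ≤ ε := by
    have hK : (0 : ℝ) < K + 2 := by positivity
    refine ⟨min (ε / (K + 2)) 1, by positivity, min_le_right _ _, ?_⟩
    calc min (ε / (K + 2)) 1 * (K + 2) ≤ ε / (K + 2) * (K + 2) := by gcongr; exact min_le_left _ _
      _ = ε := by field_simp
  have hk4 : 0 < κ / 4 := by positivity
  have h1 := eventually_log_rothDen_succ_le hk4
  have h2 := (tendsto_add_atTop_nat 1).eventually h1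
  have h3 := tendsto_log_rothDen.eventually (eventually_ge_atTop (4 / κ))
  obtain ⟨n₀, hn₀⟩ := eventually_atTop.mp
    (((h1.and h2).and h3).and ((eventually_ge_atTop ⌈1 / κ⌉₊).and (eventually_ge_atTop 1)))
  filter_upwards [eventually_ge_atTop (rothDen (n₀ + 1))] with N hN
  obtain ⟨m, hm1, hm2⟩ := exists_rothDen_le_lt (N := N) ((rothDen_pos _).trans_le hN)
  have hm : n₀ + 1 < m + 1 := rothDen_strictMono.lt_iff_lt.mp (hN.trans_lt hm2)
  obtain ⟨n, rfl⟩ : ∃ n, m = n + 1 := ⟨m - 1, by omega⟩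
  obtain ⟨⟨⟨g1, g2⟩, g3⟩, g4, g5⟩ := hn₀ n (by omega)
  have hq := rothDen_cast_pos n
  have hqq : (rothDen n : ℝ) ≤ κ * N := by
    have e1 : (1 : ℝ) ≤ κ * (rothCoeff n + 1) := by
      have : (1 : ℝ) / κ ≤ n := (Nat.le_ceil _).trans (by exact_mod_cast g4)
      rw [div_le_iff₀ hκ0] at this
      unfold rothCoeff
      push_cast
      nlinarith [Nat.cast_nonneg (α := ℝ) n]
    have e2 : ((rothCoeff n + 1) * rothDen n : ℝ) ≤ N := by
      exact_mod_cast (le_rothDen_succ n).trans hm1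
    calc (rothDen n : ℝ) = 1 * rothDen n := (one_mul _).symm
      _ ≤ κ * (rothCoeff n + 1) * rothDen n := by gcongr
      _ = κ * ((rothCoeff n + 1) * rothDen n) := by ring
      _ ≤ κ * N := by gcongr
  have hqN : rothDen n ≤ N := (rothDen_strictMono.monotone (Nat.le_succ n)).trans hm1
  have hN0 : (0 : ℝ) < N := hq.trans_le (by exact_mod_cast hqN)
  refine ⟨n, g5, hqN, ?_⟩
  have hlogN : Real.log N ≤ Real.log (rothDen (n + 1 + 1)) :=
    Real.log_le_log hN0 (by exact_mod_cast hm2.le)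
  set l := Real.log (rothDen n) with hl
  rw [div_le_iff₀ hκ0] at g3
  have hl1 : 1 ≤ l := le_trans (by exact_mod_cast g5) (log_rothDen_ge n)
  have hlogN' : 1 ≤ Real.log N :=
    hl1.trans (Real.log_le_log hq (by exact_mod_cast hqN))
  have hA : (1 - κ) * Real.log N ≤ l - 1 := by
    have e1 : Real.log N ≤ (1 + κ / 4) * ((1 + κ / 4) * l) :=
      hlogN.trans (g2.trans (by gcongr))
    have e2 : (1 - κ) * Real.log N ≤ (1 - κ) * ((1 + κ / 4) * ((1 + κ / 4) * l)) := by
      apply mul_le_mul_of_nonneg_left e1; linarith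
    have e3 : (1 - κ) * ((1 + κ / 4) * (1 + κ / 4)) ≤ 1 - κ / 4 := by nlinarith [sq_nonneg κ, mul_nonneg (sq_nonneg κ) hκ0.le]
    have e4 := mul_le_mul_of_nonneg_right e3 (zero_le_one.trans hl1)
    nlinarith
  have hB : (1 - κ) * N ≤ N - rothDen n := by linarith
  have hC : (1 - κ) * N * ((1 - κ) * Real.log N) ≤ (N - rothDen n) * (l - 1) := by
    apply mul_le_mul hB hA
    · exact mul_nonneg (by linarith) (by linarith)
    · have : (rothDen n : ℝ) ≤ N := by exact_mod_cast hqN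
      linarith
  have hD : (K : ℝ) * rothDen n ≤ K * (κ * (N * Real.log N)) := by
    gcongr
    calc (rothDen n : ℝ) ≤ κ * N := hqq
      _ ≤ κ * (N * Real.log N) := by
        gcongr
        nlinarith
  have hNl : 0 ≤ N * Real.log N := by positivity
  have hE := mul_le_mul_of_nonneg_right hκ hNl
  have hF : 0 ≤ κ ^ 2 * (N * Real.log N) := by positivity
  linarith

/-- The trimmed sums are asymptotically at least `N log N`. -/
lemma eventually_le_trimmedSum (K : ℕ) {ε : ℝ} (hε : 0 < ε) :
    ∀ᶠ N : ℕ in atTop, ∀ x ∈ Set.Ico (0 : ℝ) 1, AvoidsZero rothAngle x →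
      (1 - ε) * (N * Real.log N) ≤ trimmedSum (rotationMap rothAngle) recip K N x := by
  filter_upwards [eventually_exists_rothDen_bound K hε, eventually_ge_atTop K] with N hN hKN x hx hx0
  obtain ⟨n, hn1, -, hn⟩ := hN
  have h1 := sub_mul_log_le_birkhoffSum hn1 hx hx0 N le_rfl
  have h2 := le_trimmedSum (rotationMap rothAngle) recip (rothDen n) hKN x
  linarith

lemma eventually_le_truncated {ε : ℝ} (hε : 0 < ε) :
    ∀ᶠ N : ℕ in atTop, ∀ x ∈ Set.Ico (0 : ℝ) 1, AvoidsZero rothAngle x →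
      (1 - ε) * (N * Real.log N) ≤ birkhoffSum (rotationMap rothAngle)
        (fun y => min (recip y) (N * Real.log N)) N x := by
  filter_upwards [eventually_exists_rothDen_bound 0 hε, eventually_ge_atTop 3] with N hN hN3 x hx hx0
  obtain ⟨n, hn1, hn2, hn⟩ := hN
  have hN3' : (3 : ℝ) ≤ N := by exact_mod_cast hN3
  have hlog : 1 ≤ Real.log N := by
    rw [Real.le_log_iff_exp_le (by linarith)]
    linarith [Real.exp_one_lt_d9]
  have h1 := sub_mul_log_le_birkhoffSum hn1 hx hx0 N (L := N * Real.log N) (by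
    have : (rothDen n : ℝ) ≤ N := by exact_mod_cast hn2
    nlinarith)
  rw [Nat.cast_zero, zero_mul, sub_zero] at hn
  linarith

/-! ### Large trimmed sums after a close approach. -/

/-- Close approach of the orbit to `0` at time scale `rothDen n` makes a trimmed sum large. -/
lemma eventually_exists_le_trimmedSum (K : ℕ) :
    ∀ᶠ n in atTop, ∃ N ≥ n, ∀ x ∈ Set.Ico (0 : ℝ) 1, AvoidsZero rothAngle x →
      Int.fract (rothDen n * x) < 1 / (2 * Real.log (rothDen n)) →
      3 / 2 * (N * Real.log N) ≤ trimmedSum (rotationMap rothAngle) recip K N x := by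
  have hK : (0 : ℝ) < 1 / (8 * (3 * K + 1)) := by positivity
  filter_upwards [eventually_log_rothDen_succ_le (show (0 : ℝ) < 1 / 24 by norm_num),
    tendsto_log_rothDen.eventually (eventually_ge_atTop 16),
    (isLittleO_log_add_natCast 2).def hK] with n h1 h2 h3
  have hq := rothDen_cast_pos n
  have hq1 := rothDen_cast_pos (n + 1)
  have hlog_le := log_rothDen_le n
  set l := Real.log (rothDen n) with hl
  have hn0 : (0 : ℝ) ≤ n := Nat.cast_nonneg n
  rw [Real.norm_of_nonneg (Real.log_nonneg (by linarith)), Real.norm_of_nonneg hn0] at h3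
  -- With this many periods the drift is at most 1/(2l); added to the initial 1/(2l) it gives η =
  -- 1/l.
  set b := ⌊(rothDen (n + 1) : ℝ) / rothDen n / (4 * l)⌋₊ with hb
  -- Here q_{n+1}/q_n ≥ n^2 beats l ≤ 2n log(n+2); the K deleted terms then cost less than a third
  -- of the bl gained.
  have hb1 : 3 * K + 1 ≤ b := by
    apply Nat.le_floor
    have h4 : (rothCoeff n + 1 : ℝ) ≤ rothDen (n + 1) / rothDen n := by
      rw [le_div_iff₀ hq]
      exact_mod_cast le_rothDen_succ n
    rw [le_div_iff₀ (by positivity)]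
    refine le_trans ?_ h4
    rw [div_mul_eq_mul_div, one_mul, le_div_iff₀ (by positivity)] at h3
    calc ((3 * K + 1 : ℕ) : ℝ) * (4 * l) ≤ (3 * K + 1) * (4 * (2 * n * Real.log (n + 2))) := by
          push_cast; gcongr
      _ = n * (Real.log (n + 2) * (8 * (3 * K + 1))) := by ring
      _ ≤ n * n := by gcongr
      _ ≤ rothCoeff n + 1 := by unfold rothCoeff; push_cast; nlinarith
  have hb2 : (b : ℝ) * (4 * l) * rothDen n ≤ rothDen (n + 1) := by
    have : (b : ℝ) ≤ (rothDen (n + 1) : ℝ) / rothDen n / (4 * l) := Nat.floor_le (by positivity)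
    rw [div_div, le_div_iff₀ (by positivity)] at this
    linarith
  have hb1' : (3 * K + 1 : ℝ) ≤ b := by exact_mod_cast hb1
  have hqN : rothDen n ≤ b * rothDen n := Nat.le_mul_of_pos_left _ (by omega)
  refine ⟨b * rothDen n, ?_, ?_⟩
  · have := (Nat.lt_pow_self (n := n) (show 1 < 4 by norm_num))
    have := four_pow_le_rothDen n
    omega
  intro x hx hx0 hfr
  have hKN : K ≤ b * rothDen n := by nlinarith [rothDen_pos n]
  have herr : b * rothDen n * (rothDen n * rothAngle - rothNum n) ≤ 1 / (2 * l) := by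
    calc b * rothDen n * (rothDen n * rothAngle - rothNum n)
        ≤ b * rothDen n * (2 / rothDen (n + 1)) := by gcongr; exact rothErr_le n
      _ = (b * (4 * l) * rothDen n) / (2 * l * rothDen (n + 1)) := by field_simp; ring
      _ ≤ rothDen (n + 1) / (2 * l * rothDen (n + 1)) := by gcongr
      _ = 1 / (2 * l) := by field_simp
  have hsum := le_birkhoffSum_of_fract_le (rothDen_pos n) (rothDen_coprime n) (rothErr_pos n).le hx
    hx0 (b := b) (η := 1 / l) (by positivity) (by
      have : 1 / l = 1 / (2 * l) + 1 / (2 * l) := by field_simp; norm_num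
      linarith)
  have hsum2 := sum_div_add_ge (rothDen_pos n) (η := 1 / l) (by positivity)
    (by rw [div_le_one (by positivity)]; linarith)
  have htrim := le_trimmedSum (rotationMap rothAngle) recip (rothDen n / (1 / l)) hKN x
  rw [one_div_one_div, ← hl] at hsum2
  rw [div_div_eq_mul_div, div_one] at hsum htrim
  have hmain : b * (rothDen n * (l + l - 1)) - K * (rothDen n * l) ≤
      trimmedSum (rotationMap rothAngle) recip K (b * rothDen n) x := by
    have := mul_le_mul_of_nonneg_left hsum2 (Nat.cast_nonneg (α := ℝ) b)
    linarith
  refine le_trans ?_ hmain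
  have hlogN : Real.log ((b * rothDen n : ℕ) : ℝ) ≤ (1 + 1 / 24) * l := by
    refine le_trans (Real.log_le_log ?_ ?_) h1
    · push_cast
      have : (0 : ℝ) < b := by linarith [Nat.cast_nonneg (α := ℝ) K]
      positivity
    · push_cast
      refine le_trans ?_ hb2
      have : (0 : ℝ) ≤ b * rothDen n := by positivity
      nlinarith
  -- The left side is (25/16) bl; the right side is at least (5/3) bl - b, and l ≥ 16 covers the
  -- gap.
  have hfin : 3 / 2 * (b * ((1 + 1 / 24) * l)) ≤ b * (l + l - 1) - K * l := by
    nlinarith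
  calc 3 / 2 * (((b * rothDen n : ℕ) : ℝ) * Real.log ((b * rothDen n : ℕ) : ℝ))
      ≤ 3 / 2 * (((b * rothDen n : ℕ) : ℝ) * ((1 + 1 / 24) * l)) := by gcongr
    _ = rothDen n * (3 / 2 * (b * ((1 + 1 / 24) * l))) := by push_cast; ring
    _ ≤ rothDen n * (b * (l + l - 1) - K * l) := by gcongr
    _ = _ := by ring

/-! ### Infinitely many close approaches almost surely. -/

/-- A Borel–Cantelli lemma for events with summable correlations. -/
lemma ae_frequently_mem_of_correlation {Ω : Type*} [MeasurableSpace Ω] (μ : Measure Ω)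
    [IsProbabilityMeasure μ] {A : ℕ → Set Ω} (hA : ∀ n, MeasurableSet (A n)) {e : ℕ → ℕ → ℝ} {C : ℝ}
    (he : ∀ (s : Finset ℕ) (n : ℕ), ∑ m ∈ s, e m n ≤ C)
    (hcor : ∀ m n, μ.real (A m ∩ A n) ≤
      μ.real (A m) * μ.real (A n) + μ.real (A n) * e m n + μ.real (A m) * e n m)
    (hsum : ¬Summable fun n => μ.real (A n)) :
    ∀ᵐ x ∂μ, ∃ᶠ n in atTop, x ∈ A n := by
  -- Chebyshev's inequality for the number Y of events that occur: its mean is t, its variance at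
  -- most 2Ct, and Y = 0 on B.
  have hcheb : ∀ s : Finset ℕ, ∀ B : Set Ω, MeasurableSet B → (∀ n ∈ s, Disjoint B (A n)) →
      (∑ n ∈ s, μ.real (A n)) ^ 2 * μ.real B ≤ (2 * C) * ∑ n ∈ s, μ.real (A n) := by
    intro s B hB hdisj
    set t := ∑ n ∈ s, μ.real (A n) with ht
    let Y : Ω → ℝ := fun x => ∑ n ∈ s, (A n).indicator 1 x
    have hind : ∀ S : Set Ω, MeasurableSet S → Integrable (S.indicator (1 : Ω → ℝ)) μ := fun S hS =>
      (integrable_const (1 : ℝ)).indicator hS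
    have hY : Integrable Y μ := integrable_finsetSum _ fun n _ => hind _ (hA n)
    have hYY : ∀ x, Y x ^ 2 = ∑ m ∈ s, ∑ n ∈ s, (A m ∩ A n).indicator (1 : Ω → ℝ) x := fun x => by
      simp only [Y, sq, Finset.sum_mul_sum, Set.inter_indicator_one, Pi.mul_apply]
    have hY2i : Integrable (fun x => Y x ^ 2) μ := by
      simp_rw [hYY]
      exact integrable_finsetSum _ fun m _ => integrable_finsetSum _ fun n _ =>
        hind _ ((hA m).inter (hA n))
    have hYint : ∫ x, Y x ∂μ = t := by
      rw [integral_finsetSum _ fun n _ => hind _ (hA n)]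
      exact Finset.sum_congr rfl fun n _ => integral_indicator_one (hA n)
    have hY2 : ∫ x, Y x ^ 2 ∂μ ≤ t ^ 2 + 2 * C * t := by
      simp_rw [hYY]
      rw [integral_finsetSum _ fun m _ => integrable_finsetSum _ fun n _ =>
        hind _ ((hA m).inter (hA n))]
      have h1 : ∀ m ∈ s, ∫ x, ∑ n ∈ s, (A m ∩ A n).indicator (1 : Ω → ℝ) x ∂μ ≤
          ∑ n ∈ s, (μ.real (A m) * μ.real (A n) + μ.real (A n) * e m n + μ.real (A m) * e n m) := by
        intro m _
        rw [integral_finsetSum _ fun n _ => hind _ ((hA m).inter (hA n))]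
        refine Finset.sum_le_sum fun n _ => ?_
        rw [integral_indicator_one ((hA m).inter (hA n))]
        exact hcor m n
      refine (Finset.sum_le_sum h1).trans ?_
      simp only [Finset.sum_add_distrib]
      have h2 : ∑ m ∈ s, ∑ n ∈ s, μ.real (A m) * μ.real (A n) = t ^ 2 := by
        rw [sq, ht, Finset.sum_mul_sum]
      have h3 : ∑ m ∈ s, ∑ n ∈ s, μ.real (A m) * e n m ≤ C * t := by
        rw [ht, Finset.mul_sum]
        refine Finset.sum_le_sum fun m _ => ?_
        rw [← Finset.mul_sum, mul_comm C]
        exact mul_le_mul_of_nonneg_left (he s m) measureReal_nonneg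
      have h4 : ∑ m ∈ s, ∑ n ∈ s, μ.real (A n) * e m n ≤ C * t := by
        rwa [Finset.sum_comm]
      linarith
    have hvar : ∫ x, (Y x - t) ^ 2 ∂μ ≤ 2 * C * t := by
      have : ∀ x, (Y x - t) ^ 2 = Y x ^ 2 - 2 * t * Y x + t ^ 2 := fun x => by ring
      simp_rw [this]
      have e1 : ∫ x, Y x ^ 2 - 2 * t * Y x + t ^ 2 ∂μ =
          ∫ x, Y x ^ 2 - 2 * t * Y x ∂μ + ∫ _, t ^ 2 ∂μ :=
        integral_add (hY2i.sub (hY.const_mul _)) (integrable_const _)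
      have e2 : ∫ x, Y x ^ 2 - 2 * t * Y x ∂μ = ∫ x, Y x ^ 2 ∂μ - ∫ x, 2 * t * Y x ∂μ :=
        integral_sub hY2i (hY.const_mul _)
      rw [e1, e2, integral_const_mul, hYint, integral_const]
      simp only [probReal_univ, one_smul]
      linarith
    have hvari : Integrable (fun x => (Y x - t) ^ 2) μ := by
      have : ∀ x, (Y x - t) ^ 2 = Y x ^ 2 - 2 * t * Y x + t ^ 2 := fun x => by ring
      simp_rw [this]
      exact (hY2i.sub (hY.const_mul _)).add (integrable_const _)
    refine le_trans ?_ hvar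
    calc t ^ 2 * μ.real B = ∫ x, B.indicator (fun _ => t ^ 2) x ∂μ := by
          rw [integral_indicator_const _ hB, smul_eq_mul, mul_comm]
      _ ≤ _ := by
        refine integral_mono ((integrable_const _).indicator hB) hvari fun x => ?_
        by_cases hx : x ∈ B
        · have : Y x = 0 := Finset.sum_eq_zero fun n hn =>
            Set.indicator_of_notMem (Set.disjoint_left.mp (hdisj n hn) hx) _
          simp [hx, this]
        · simp only [Set.indicator_of_notMem hx]
          positivity
  have htend := (not_summable_iff_tendsto_nat_atTop_of_nonneg fun n => measureReal_nonneg).mp hsum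
  have hnull : ∀ n₀, μ (⋂ n ≥ n₀, (A n)ᶜ) = 0 := by
    intro n₀
    set B := ⋂ n ≥ n₀, (A n)ᶜ with hB
    have hBm : MeasurableSet B :=
      MeasurableSet.iInter fun n => MeasurableSet.iInter fun _ => (hA n).compl
    by_contra hne
    have hpos : 0 < μ.real B := by
      rw [measureReal_def, ENNReal.toReal_pos_iff]
      exact ⟨pos_iff_ne_zero.mpr hne, measure_lt_top _ _⟩
    have h1 : Tendsto (fun M => ∑ n ∈ Finset.range M, μ.real (A n) -
        ∑ n ∈ Finset.range n₀, μ.real (A n)) atTop atTop :=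
      tendsto_atTop_add_const_right _ _ htend
    obtain ⟨M, hM1, hM2, hM3⟩ := ((h1.eventually (eventually_gt_atTop (2 * C / μ.real B))).and
      ((h1.eventually (eventually_gt_atTop 0)).and (eventually_ge_atTop n₀))).exists
    rw [← Finset.sum_Ico_eq_sub _ hM3] at hM1 hM2
    have := hcheb (Finset.Ico n₀ M) B hBm fun n hn => by
      rw [Set.disjoint_left]
      intro x hx
      exact Set.mem_iInter₂.mp hx n (Finset.mem_Ico.mp hn).1
    rw [div_lt_iff₀ hpos] at hM1
    nlinarith
  have hall : ∀ᵐ x ∂μ, ∀ n₀, x ∉ ⋂ n ≥ n₀, (A n)ᶜ :=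
    ae_all_iff.mpr fun n₀ => measure_eq_zero_iff_ae_notMem.mp (hnull n₀)
  filter_upwards [hall] with x hx
  rw [frequently_atTop]
  intro n₀
  have := hx n₀
  simp only [Set.mem_iInter, Set.mem_compl_iff, not_forall, not_not] at this
  obtain ⟨n, hn, hxn⟩ := this
  exact ⟨n, hn, hxn⟩

instance : IsProbabilityMeasure unitMeasure := ⟨by simp [unitMeasure]⟩

lemma ae_mem_Ico_unitMeasure : ∀ᵐ x ∂unitMeasure, x ∈ Set.Ico (0 : ℝ) 1 :=
  ae_restrict_mem measurableSet_Ico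

lemma ae_avoidsZero (α : ℝ) : ∀ᵐ x ∂unitMeasure, AvoidsZero α x := by
  refine ae_restrict_of_ae (ae_all_iff.mpr fun n => ?_)
  have hc : (Set.range fun z : ℤ => (z : ℝ) - n * α).Countable := Set.countable_range _
  filter_upwards [hc.ae_notMem volume] with x hx h0
  refine hx ⟨⌊x + n * α⌋, ?_⟩
  have := Int.floor_add_fract (x + n * α)
  simp only
  linarith

lemma volume_fract_mem_le {q : ℕ} (hq : 0 < q) {s t : ℝ} {S : Set ℝ} (F : Finset ℤ)
    (hF : ∀ x ∈ S, ⌊q * x⌋ ∈ F) :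
    volume {x ∈ S | Int.fract (q * x) ∈ Set.Ico s t} ≤ ENNReal.ofReal (F.card * ((t - s) / q)) := by
  have hq' : (0 : ℝ) < q := by exact_mod_cast hq
  calc volume {x ∈ S | Int.fract (q * x) ∈ Set.Ico s t}
      ≤ volume (⋃ k ∈ F, Set.Ico (((k : ℝ) + s) / q) ((k + t) / q)) := by
        refine measure_mono fun x hx => Set.mem_iUnion₂.mpr ⟨⌊q * x⌋, hF x hx.1, ?_⟩
        have h1 := Int.floor_add_fract (q * x)
        have h2 := hx.2
        rw [Set.mem_Ico, div_le_iff₀ hq', lt_div_iff₀ hq']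
        constructor <;> linarith [h2.1, h2.2]
    _ ≤ ∑ k ∈ F, volume (Set.Ico (((k : ℝ) + s) / q) ((k + t) / q)) :=
        measure_biUnion_finset_le _ _
    _ = ∑ _k ∈ F, ENNReal.ofReal ((t - s) / q) := by
        refine Finset.sum_congr rfl fun k _ => ?_
        rw [Real.volume_Ico]
        congr 1
        ring
    _ = _ := by
        rw [Finset.sum_const, ← ENNReal.ofReal_nsmul, nsmul_eq_mul]

/-- At most qℓ + 2 cells of the 1/q-grid meet the interval, each contributing at most τ/q. -/
lemma volume_interval_fract_mem_le {q : ℕ} (hq : 0 < q) {τ : ℝ} (hτ : 0 ≤ τ) (a : ℝ) {ℓ : ℝ}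
    (hℓ : 0 ≤ ℓ) : volume {x ∈ Set.Ico a (a + ℓ) | Int.fract (q * x) ∈ Set.Ico 0 τ} ≤
      ENNReal.ofReal (τ * (ℓ + 2 / q)) := by
  have hq' : (0 : ℝ) < q := by exact_mod_cast hq
  refine (volume_fract_mem_le hq (Finset.Icc ⌊q * a⌋ ⌊q * (a + ℓ)⌋) (fun x hx => ?_)).trans
    (ENNReal.ofReal_le_ofReal ?_)
  · rw [Finset.mem_Icc]
    exact ⟨Int.floor_mono (by gcongr; exact hx.1), Int.floor_mono (by gcongr; exact hx.2.le)⟩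
  · have hle : ⌊q * a⌋ ≤ ⌊q * (a + ℓ)⌋ := Int.floor_mono (by gcongr; linarith)
    have hcard : ((Finset.Icc ⌊q * a⌋ ⌊q * (a + ℓ)⌋).card : ℝ) ≤ q * ℓ + 2 := by
      rw [Int.card_Icc]
      have h1 : (((⌊q * (a + ℓ)⌋ + 1 - ⌊q * a⌋).toNat : ℤ) : ℝ) = ⌊q * (a + ℓ)⌋ + 1 - ⌊q * a⌋ := by
        rw [Int.toNat_of_nonneg (by omega)]
        push_cast
        ring
      rw [Int.cast_natCast] at h1
      rw [h1]
      linarith [Int.floor_le (q * (a + ℓ)), Int.sub_one_lt_floor (q * a)]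
    calc ((Finset.Icc ⌊q * a⌋ ⌊q * (a + ℓ)⌋).card : ℝ) * ((τ - 0) / q)
        ≤ (q * ℓ + 2) * ((τ - 0) / q) := by
          gcongr
      _ = _ := by field_simp; ring

/-- The points of `[0, 1)` close to the right of a multiple of `1 / q`. -/
def fractNear (q : ℕ) (τ : ℝ) : Set ℝ := {x | Int.fract (q * x) < τ}

lemma measurableSet_fractNear (q : ℕ) (τ : ℝ) : MeasurableSet (fractNear q τ) :=
  measurableSet_lt (measurable_fract.comp (measurable_const.mul measurable_id)) measurable_const

lemma unitMeasure_apply {s : Set ℝ} (hs : MeasurableSet s) :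
    unitMeasure s = volume {x ∈ Set.Ico (0 : ℝ) 1 | x ∈ s} := by
  rw [unitMeasure, Measure.restrict_apply hs, Set.inter_comm]
  rfl

lemma unitMeasure_fract_mem_le {q : ℕ} (hq : 0 < q) {s t : ℝ} (hst : s ≤ t) :
    unitMeasure.real {x | Int.fract (q * x) ∈ Set.Ico s t} ≤ t - s := by
  have hq' : (0 : ℝ) < q := by exact_mod_cast hq
  have hm : MeasurableSet {x : ℝ | Int.fract (q * x) ∈ Set.Ico s t} :=
    (measurable_fract.comp (measurable_const.mul measurable_id)) measurableSet_Ico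
  rw [measureReal_def, unitMeasure_apply hm]
  refine ENNReal.toReal_le_of_le_ofReal (by linarith) ?_
  refine (volume_fract_mem_le hq (Finset.Ico 0 (q : ℤ)) (fun x hx => ?_)).trans_eq ?_
  · rw [Finset.mem_Ico]
    refine ⟨Int.floor_nonneg.mpr (mul_nonneg hq'.le hx.1), Int.floor_lt.mpr ?_⟩
    push_cast
    nlinarith [hx.2]
  · congr 1
    simp only [Int.card_Ico, sub_zero, Int.toNat_natCast]
    field_simp

lemma unitMeasure_fractNear {q : ℕ} (hq : 0 < q) {τ : ℝ} (hτ : 0 ≤ τ) (hτ1 : τ ≤ 1) :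
    unitMeasure.real (fractNear q τ) = τ := by
  refine le_antisymm ?_ ?_
  · refine le_trans (measureReal_mono fun x hx => ?_)
      ((unitMeasure_fract_mem_le hq hτ).trans_eq (sub_zero τ))
    exact ⟨Int.fract_nonneg _, hx⟩
  -- The lower bound is the upper bound applied to the complementary range [τ, 1).
  · have h1 : unitMeasure.real (fractNear q τ)ᶜ ≤ 1 - τ := by
      refine le_trans (measureReal_mono fun x hx => ?_) (unitMeasure_fract_mem_le hq hτ1)
      exact ⟨not_lt.mp hx, Int.fract_lt_one _⟩
    rw [probReal_compl_eq_one_sub (measurableSet_fractNear q τ)] at h1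
    linarith

/-- The first set consists of q intervals of length σ/q. The finer grid is nearly equidistributed in
each, and the boundary cells cost the term in q/r, which decays geometrically along `rothDen`. -/
lemma unitMeasure_fractNear_inter_le {q r : ℕ} (hq : 0 < q) (hr : 0 < r) {σ τ : ℝ} (hσ : 0 ≤ σ)
    (hτ : 0 ≤ τ) : unitMeasure.real (fractNear q σ ∩ fractNear r τ) ≤ τ * (σ + 2 * (q / r)) := by
  have hq' : (0 : ℝ) < q := by exact_mod_cast hq
  have hr' : (0 : ℝ) < r := by exact_mod_cast hr
  rw [measureReal_def,
    unitMeasure_apply ((measurableSet_fractNear q σ).inter (measurableSet_fractNear r τ))]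
  refine ENNReal.toReal_le_of_le_ofReal (by positivity) ?_
  calc volume {x ∈ Set.Ico (0 : ℝ) 1 | x ∈ fractNear q σ ∩ fractNear r τ}
      ≤ volume (⋃ k ∈ Finset.range q, {x ∈ Set.Ico ((k : ℝ) / q) (k / q + σ / q) |
          Int.fract (r * x) ∈ Set.Ico 0 τ}) := by
        refine measure_mono fun x hx => ?_
        obtain ⟨hx01, hxq, hxr⟩ := hx
        have hfl : 0 ≤ ⌊q * x⌋ := Int.floor_nonneg.mpr (mul_nonneg hq'.le hx01.1)
        obtain ⟨k, hk⟩ := Int.eq_ofNat_of_zero_le hfl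
        have h1 := Int.floor_add_fract (q * x)
        rw [hk, Int.cast_natCast] at h1
        have h2 := Int.fract_nonneg (q * x)
        have h3 : Int.fract (q * x) < σ := hxq
        refine Set.mem_iUnion₂.mpr ⟨k, ?_, ?_, Int.fract_nonneg _, hxr⟩
        · rw [Finset.mem_range]
          have : (k : ℝ) < q := by nlinarith [hx01.2]
          exact_mod_cast this
        · rw [Set.mem_Ico, ← add_div, div_le_iff₀ hq', lt_div_iff₀ hq']
          constructor <;> linarith
    _ ≤ ∑ k ∈ Finset.range q, volume {x ∈ Set.Ico ((k : ℝ) / q) (k / q + σ / q) |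
          Int.fract (r * x) ∈ Set.Ico 0 τ} := measure_biUnion_finset_le _ _
    _ ≤ ∑ _k ∈ Finset.range q, ENNReal.ofReal (τ * (σ / q + 2 / r)) :=
        Finset.sum_le_sum fun k _ => volume_interval_fract_mem_le hr hτ _ (by positivity)
    _ = ENNReal.ofReal (τ * (σ + 2 * (q / r))) := by
        rw [Finset.sum_const, ← ENNReal.ofReal_nsmul, nsmul_eq_mul, Finset.card_range]
        congr 1
        field_simp

lemma sum_ite_geometric_le (s : Finset ℕ) (n : ℕ) :
    ∑ m ∈ s, (if m ≤ n then 2 * (1 / 2 : ℝ) ^ (n - m) else 0) ≤ 4 := by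
  rw [← Finset.sum_filter]
  calc ∑ m ∈ s with m ≤ n, 2 * (1 / 2 : ℝ) ^ (n - m)
      ≤ ∑ m ∈ Finset.range (n + 1), 2 * (1 / 2 : ℝ) ^ (n - m) := by
        refine Finset.sum_le_sum_of_subset_of_nonneg (fun m hm => ?_) fun _ _ _ => by positivity
        have := (Finset.mem_filter.mp hm).2
        exact Finset.mem_range.mpr (by omega)
    _ = 2 * ∑ m ∈ Finset.range (n + 1), (1 / 2 : ℝ) ^ m := by
        rw [← Finset.sum_range_reflect, Finset.mul_sum]
        refine Finset.sum_congr rfl fun m hm => ?_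
        have := Finset.mem_range.mp hm
        congr 2
        omega
    _ ≤ 2 * 2 := by
        gcongr
        exact (summable_geometric_two.sum_le_tsum _ fun _ _ => by positivity).trans_eq
          tsum_geometric_two
    _ = 4 := by norm_num

lemma rothDen_div_le {m n : ℕ} (hmn : m ≤ n) :
    (rothDen m : ℝ) / rothDen n ≤ (1 / 2 : ℝ) ^ (n - m) := by
  induction n, hmn using Nat.le_induction with
  | base => simp [(rothDen_cast_pos m).ne']
  | succ n hmn ih =>
    have h0 := rothDen_cast_pos n
    have h1 := rothDen_cast_pos (n + 1)
    have h4 : (4 : ℝ) * rothDen n ≤ rothDen (n + 1) := by exact_mod_cast four_mul_rothDen_le n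
    rw [Nat.succ_sub hmn, pow_succ]
    calc (rothDen m : ℝ) / rothDen (n + 1) = rothDen m / rothDen n * (rothDen n / rothDen (n + 1)) := by
          field_simp
      _ ≤ _ := by
        refine mul_le_mul ih ?_ (by positivity) (by positivity)
        rw [div_le_div_iff₀ h1 two_pos]
        linarith

/-- Cauchy condensation: the terms at 2^k, weighted by 2^k, are at least 1/(4(k+2)). -/
lemma not_summable_one_div_log_rothDen :
    ¬Summable fun n => 1 / (2 * Real.log (rothDen n)) := by
  have hnn : ∀ n, 0 ≤ Real.log (rothDen n) := fun n => Real.log_nonneg (one_le_rothDen_cast n)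
  rw [← summable_condensed_iff_of_nonneg]
  · intro h
    have h2 : Summable fun k : ℕ => 1 / 4 * (1 / ((k + 2 : ℕ) : ℝ)) := by
      refine Summable.of_nonneg_of_le (fun k => by positivity) (fun k => ?_) h
      have hl : 0 < Real.log (rothDen (2 ^ k)) := by
        have h1 := log_rothDen_ge (2 ^ k)
        have : (0 : ℝ) < ((2 ^ k : ℕ) : ℝ) := by positivity
        linarith
      have hlog : Real.log ((2 : ℝ) ^ k + 2) ≤ k + 2 := by
        calc Real.log ((2 : ℝ) ^ k + 2) ≤ Real.log (2 ^ (k + 2)) := by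
              apply Real.log_le_log (by positivity)
              have : (1 : ℝ) ≤ 2 ^ k := one_le_pow₀ (by norm_num)
              rw [pow_add]
              linarith
          _ = (k + 2) * Real.log 2 := by rw [Real.log_pow]; push_cast; ring
          _ ≤ (k + 2) * 1 := by gcongr; linarith [Real.log_two_lt_d9]
          _ = _ := mul_one _
      have h3 := log_rothDen_le (2 ^ k)
      push_cast at h3 ⊢
      rw [div_mul_div_comm, mul_one_div, div_le_div_iff₀ (by positivity) (by positivity)]
      have : (2 : ℝ) * 2 ^ k * Real.log (2 ^ k + 2) ≤ 2 * 2 ^ k * (k + 2) := by gcongr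
      linarith
    rw [summable_mul_left_iff (by norm_num)] at h2
    exact Real.not_summable_one_div_natCast
      ((summable_nat_add_iff (f := fun k : ℕ => 1 / (k : ℝ)) 2).mp h2)
  · intro n
    have := hnn n
    positivity
  · intro m n hm hmn
    have h1 : (1 : ℝ) ≤ m := by exact_mod_cast hm
    have h2 := log_rothDen_ge m
    have h3 := Real.log_le_log (rothDen_cast_pos m)
      (show (rothDen m : ℝ) ≤ rothDen n by exact_mod_cast rothDen_strictMono.monotone hmn)
    gcongr
    linarith

lemma ae_frequently_fract_lt : ∀ᵐ x : ℝ ∂unitMeasure, ∃ᶠ n in atTop,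
    Int.fract (rothDen n * x) < 1 / (2 * Real.log (rothDen n)) := by
  have h0 : ∀ n, 0 ≤ 1 / (2 * Real.log (rothDen n)) := fun n => by
    have := Real.log_nonneg (one_le_rothDen_cast n)
    positivity
  have h1 : ∀ n, 1 / (2 * Real.log (rothDen n)) ≤ 1 := fun n => by
    -- For n = 0 the logarithm vanishes and the quotient is 0 by convention.
    rcases Nat.eq_zero_or_pos n with rfl | hn
    · simp [rothDen_zero]
    · have h1 : (1 : ℝ) ≤ n := by exact_mod_cast hn
      have h2 := log_rothDen_ge n
      rw [div_le_one (by linarith)]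
      linarith
  have hμ : ∀ n, unitMeasure.real (fractNear (rothDen n) (1 / (2 * Real.log (rothDen n)))) =
      1 / (2 * Real.log (rothDen n)) := fun n =>
    unitMeasure_fractNear (rothDen_pos n) (h0 n) (h1 n)
  refine ae_frequently_mem_of_correlation unitMeasure
    (A := fun n => fractNear (rothDen n) (1 / (2 * Real.log (rothDen n))))
    (e := fun m n => if m ≤ n then 2 * (1 / 2 : ℝ) ^ (n - m) else 0) (C := 4)
    (fun n => measurableSet_fractNear _ _) sum_ite_geometric_le (fun m n => ?_) ?_
  · simp only [hμ]
    have key : ∀ {m n : ℕ}, m ≤ n →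
        unitMeasure.real (fractNear (rothDen m) (1 / (2 * Real.log (rothDen m))) ∩
          fractNear (rothDen n) (1 / (2 * Real.log (rothDen n)))) ≤
        1 / (2 * Real.log (rothDen m)) * (1 / (2 * Real.log (rothDen n))) +
          1 / (2 * Real.log (rothDen n)) * (2 * (1 / 2 : ℝ) ^ (n - m)) := fun {m n} hmn => by
      refine (unitMeasure_fractNear_inter_le (rothDen_pos m) (rothDen_pos n) (h0 m) (h0 n)).trans ?_
      rw [mul_add, mul_comm (1 / (2 * Real.log (rothDen m)))]
      have := h0 n
      have := rothDen_div_le hmn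
      gcongr
    have hnn : ∀ a b : ℕ, 0 ≤ 1 / (2 * Real.log (rothDen a)) *
        (if b ≤ a then 2 * (1 / 2 : ℝ) ^ (a - b) else 0) := fun a b => by
      refine mul_nonneg (h0 a) ?_
      split_ifs <;> positivity
    rcases le_total m n with h | h
    · have h2 := key h
      have h3 := hnn m n
      rw [if_pos h]
      linarith
    · have h2 := key h
      have h3 := hnn n m
      rw [Set.inter_comm, if_pos h]
      linarith
  · simp only [hμ]
    exact not_summable_one_div_log_rothDen

/-! ### The weak law. -/

lemma integral_unitMeasure (g : ℝ → ℝ) : ∫ x, g x ∂unitMeasure = ∫ x in (0 : ℝ)..1, g x := by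
  rw [unitMeasure, integral_Ico_eq_integral_Ioc, intervalIntegral.integral_of_le zero_le_one]

lemma integral_fract_add (g : ℝ → ℝ) (c : ℝ) :
    ∫ x, g (Int.fract (x + c)) ∂unitMeasure = ∫ x, g x ∂unitMeasure := by
  have hper : Function.Periodic (fun x => g (Int.fract x)) 1 := fun x => by
    simp only [Int.fract_add_one]
  have h1 : ∫ x in (0 : ℝ)..1, g (Int.fract (x + c)) = ∫ x in (0 : ℝ)..1, g (Int.fract x) := by
    rw [intervalIntegral.integral_comp_add_right (fun x => g (Int.fract x)) c, zero_add, add_comm]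
    have := hper.intervalIntegral_add_eq c 0
    rwa [zero_add] at this
  rw [integral_unitMeasure, h1, ← integral_unitMeasure]
  refine integral_congr_ae ?_
  filter_upwards [ae_mem_Ico_unitMeasure] with x hx
  rw [Int.fract_eq_self.mpr hx]

lemma integrable_unitMeasure_of_bounded {g : ℝ → ℝ} (hg : Measurable g) {C : ℝ}
    (hC : ∀ x ∈ Set.Ico (0 : ℝ) 1, |g x| ≤ C) : Integrable g unitMeasure :=
  Integrable.of_bound hg.aestronglyMeasurable C (by
    filter_upwards [ae_mem_Ico_unitMeasure] with x hx using hC x hx)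

lemma measurable_rotationMap (α : ℝ) : Measurable (rotationMap α) :=
  measurable_fract.comp (measurable_id.add_const α)

lemma measurable_recip : Measurable recip := measurable_const.div measurable_id

lemma integrable_comp_iterate (α : ℝ) {g : ℝ → ℝ} (hg : Measurable g) {C : ℝ}
    (hC : ∀ x ∈ Set.Ico (0 : ℝ) 1, |g x| ≤ C) (n : ℕ) :
    Integrable (fun x => g ((rotationMap α)^[n] x)) unitMeasure := by
  refine integrable_unitMeasure_of_bounded (C := C)
    (hg.comp ((measurable_rotationMap α).iterate n)) fun x hx => ?_
  exact hC _ (rotationMap_iterate_mem hx α n)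

lemma integrable_birkhoffSum (α : ℝ) {g : ℝ → ℝ} (hg : Measurable g) {C : ℝ}
    (hC : ∀ x ∈ Set.Ico (0 : ℝ) 1, |g x| ≤ C) (N : ℕ) :
    Integrable (birkhoffSum (rotationMap α) g N) unitMeasure :=
  integrable_finsetSum _ fun n _ => integrable_comp_iterate α hg hC n

lemma integral_birkhoffSum (α : ℝ) {g : ℝ → ℝ} (hg : Measurable g) {C : ℝ}
    (hC : ∀ x ∈ Set.Ico (0 : ℝ) 1, |g x| ≤ C) (N : ℕ) :
    ∫ x, birkhoffSum (rotationMap α) g N x ∂unitMeasure = N * ∫ x, g x ∂unitMeasure := by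
  unfold birkhoffSum
  rw [integral_finsetSum _ fun n _ => integrable_comp_iterate α hg hC n]
  have : ∀ n ∈ Finset.range N, ∫ x, g ((rotationMap α)^[n] x) ∂unitMeasure =
      ∫ x, g x ∂unitMeasure := fun n _ => by
    rw [← integral_fract_add g (n * α)]
    refine integral_congr_ae ?_
    filter_upwards [ae_mem_Ico_unitMeasure] with x hx
    rw [rotationMap_iterate hx]
  rw [Finset.sum_congr rfl this, Finset.sum_const, Finset.card_range, nsmul_eq_mul]

lemma abs_min_recip_le {L : ℝ} (hL : 0 ≤ L) {x : ℝ} (hx : x ∈ Set.Ico (0 : ℝ) 1) :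
    |min (recip x) L| ≤ L := by
  rw [abs_of_nonneg (le_min (recip_nonneg_of_nonneg hx.1) hL)]
  exact min_le_right _ _

lemma measurable_min_recip (L : ℝ) : Measurable fun x => min (recip x) L :=
  measurable_recip.min measurable_const

lemma integral_min_recip_le {L : ℝ} (hL : 1 ≤ L) :
    ∫ x, min (recip x) L ∂unitMeasure ≤ 1 + Real.log L := by
  have hL0 : 0 < L := by linarith
  have hi : 1 / L ≤ 1 := by rw [div_le_one hL0]; exact hL
  have hi0 : 0 < 1 / L := by positivity
  have hint : IntervalIntegrable (fun x => min (recip x) L) volume 0 1 := by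
    rw [intervalIntegrable_iff_integrableOn_Ico_of_le zero_le_one]
    exact integrable_unitMeasure_of_bounded (measurable_min_recip L)
      fun x hx => abs_min_recip_le hL0.le hx
  have hint1 : IntervalIntegrable (fun x => min (recip x) L) volume 0 (1 / L) :=
    hint.mono_set (by rw [Set.uIcc_of_le hi0.le, Set.uIcc_of_le zero_le_one]; gcongr)
  have hint2 : IntervalIntegrable (fun x => min (recip x) L) volume (1 / L) 1 :=
    hint.mono_set (by rw [Set.uIcc_of_le hi, Set.uIcc_of_le zero_le_one]; gcongr)
  rw [integral_unitMeasure, ← intervalIntegral.integral_add_adjacent_intervals hint1 hint2]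
  have h1 : ∫ x in (0 : ℝ)..(1 / L), min (recip x) L ≤ 1 := by
    calc ∫ x in (0 : ℝ)..(1 / L), min (recip x) L ≤ ∫ _ in (0 : ℝ)..(1 / L), L :=
          intervalIntegral.integral_mono_on hi0.le hint1 intervalIntegrable_const
            fun _ _ => min_le_right _ _
      _ = 1 := by simp [hL0.ne']
  have h2 : ∫ x in (1 / L)..(1 : ℝ), min (recip x) L ≤ Real.log L := by
    have h0 : (0 : ℝ) ∉ Set.uIcc (1 / L) 1 := by
      rw [Set.uIcc_of_le hi]
      exact fun h => absurd h.1 (not_le.mpr hi0)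
    calc ∫ x in (1 / L)..(1 : ℝ), min (recip x) L ≤ ∫ x in (1 / L)..(1 : ℝ), 1 / x :=
          intervalIntegral.integral_mono_on hi hint2
            (intervalIntegral.intervalIntegrable_one_div (fun x hx hx0 => h0 (hx0 ▸ hx))
              continuousOn_id)
            fun _ _ => min_le_left _ _
      _ = Real.log L := by rw [integral_one_div h0, one_div_one_div]
  linarith

lemma unitMeasure_exists_recip_gt_le (α : ℝ) {L : ℝ} (hL : 1 ≤ L) (N : ℕ) :
    unitMeasure.real {x | ∃ n < N, L < recip ((rotationMap α)^[n] x)} ≤ N / L := by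
  have hL0 : 0 < L := by linarith
  set g : ℝ → ℝ := {y | L < recip y}.indicator 1 with hg
  have hms : MeasurableSet {y | L < recip y} := measurableSet_lt measurable_const measurable_recip
  have hgm : Measurable g := measurable_one.indicator hms
  have hg0 : ∀ y, 0 ≤ g y := fun y => Set.indicator_nonneg (fun _ _ => zero_le_one) y
  have hgC : ∀ x ∈ Set.Ico (0 : ℝ) 1, |g x| ≤ 1 := fun x _ => by
    rw [abs_of_nonneg (hg0 x)]
    exact Set.indicator_le_self' (fun _ _ => zero_le_one) x
  have hint : ∫ x, g x ∂unitMeasure ≤ 1 / L := by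
    rw [hg, integral_indicator_one hms, measureReal_def, unitMeasure_apply hms]
    refine ENNReal.toReal_le_of_le_ofReal (by positivity) ?_
    calc volume {x ∈ Set.Ico (0 : ℝ) 1 | x ∈ {y | L < recip y}} ≤ volume (Set.Ico 0 (1 / L)) := by
          refine measure_mono fun x hx => ⟨hx.1.1, ?_⟩
          have h2 : L < 1 / x := hx.2
          have hx0 : 0 < x := one_div_pos.mp (hL0.trans h2)
          rwa [lt_div_iff₀ hx0, mul_comm, ← lt_div_iff₀ hL0] at h2
      _ = ENNReal.ofReal (1 / L) := by rw [Real.volume_Ico, sub_zero]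
  have hmarkov := mul_meas_ge_le_integral_of_nonneg (μ := unitMeasure)
    (f := birkhoffSum (rotationMap α) g N)
    (Eventually.of_forall fun x => Finset.sum_nonneg fun n _ => hg0 _)
    (integrable_birkhoffSum α hgm hgC N) 1
  rw [one_mul, integral_birkhoffSum α hgm hgC] at hmarkov
  calc unitMeasure.real {x | ∃ n < N, L < recip ((rotationMap α)^[n] x)}
      ≤ unitMeasure.real {x | 1 ≤ birkhoffSum (rotationMap α) g N x} := by
        refine measureReal_mono fun x ⟨n, hn, hx⟩ => ?_
        have h1 : g ((rotationMap α)^[n] x) = 1 := Set.indicator_of_mem (s := {y | L < recip y}) hx 1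
        have h2 := Finset.single_le_sum (f := fun n => g ((rotationMap α)^[n] x))
          (fun n _ => hg0 _) (Finset.mem_range.mpr hn)
        simp only [h1] at h2
        exact h2
    _ ≤ N * ∫ x, g x ∂unitMeasure := hmarkov
    _ ≤ N * (1 / L) := by gcongr
    _ = N / L := by ring

/-- The truncated sum minus its pointwise lower bound is nonnegative with small mean, so Markov's
inequality suffices and no variance estimate is needed. Truncation at N log N changes the sum with
probability at most 1/log N. -/
lemma eventually_measure_birkhoffSum_ge_le {ε η : ℝ} (hε : 0 < ε) (hη : 0 < η) :
    ∀ᶠ N : ℕ in atTop, unitMeasure.real {x | (1 + ε) * (N * Real.log N) ≤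
      birkhoffSum (rotationMap rothAngle) recip N x} ≤ η := by
  have hκ : 0 < ε * η / 4 := by positivity
  have hlog : Tendsto (fun N : ℕ => Real.log N) atTop atTop :=
    Real.tendsto_log_atTop.comp tendsto_natCast_atTop_atTop
  have hloglog := (Real.isLittleO_log_id_atTop.comp_tendsto hlog).def hκ
  filter_upwards [eventually_le_truncated hκ, hloglog, hlog.eventually (eventually_ge_atTop 1),
    hlog.eventually (eventually_ge_atTop (4 / η)), hlog.eventually (eventually_ge_atTop (4 / (ε * η))),
    eventually_ge_atTop 1] with N hN hll h1 h2 h3 hN1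
  simp only [Function.comp, id] at hll
  set l := Real.log N with hl
  have hN1' : (1 : ℝ) ≤ N := by exact_mod_cast hN1
  have hN0 : (0 : ℝ) < N := by linarith
  have hl0 : 0 < l := by linarith
  rw [Real.norm_of_nonneg (Real.log_nonneg h1), Real.norm_of_nonneg hl0.le] at hll
  have hL : 1 ≤ N * l := by nlinarith
  have hL0 : 0 < N * l := by linarith
  rw [div_le_iff₀ hη] at h2
  rw [div_le_iff₀ (by positivity)] at h3
  set F : ℝ → ℝ := fun y => min (recip y) (N * l) with hF
  have hFm : Measurable F := measurable_min_recip _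
  have hFC : ∀ x ∈ Set.Ico (0 : ℝ) 1, |F x| ≤ N * l := fun x hx => abs_min_recip_le hL0.le hx
  have hmarkov := mul_meas_ge_le_integral_of_nonneg (μ := unitMeasure)
    (f := fun x => birkhoffSum (rotationMap rothAngle) F N x - (1 - ε * η / 4) * (N * l))
    (by
      filter_upwards [ae_mem_Ico_unitMeasure, ae_avoidsZero rothAngle] with x hx hx0
      exact sub_nonneg.mpr (hN x hx hx0))
    ((integrable_birkhoffSum rothAngle hFm hFC N).sub (integrable_const _)) (ε * (N * l))
  rw [integral_sub (integrable_birkhoffSum rothAngle hFm hFC N) (integrable_const _),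
    integral_birkhoffSum rothAngle hFm hFC, integral_const, probReal_univ, one_smul] at hmarkov
  have hint := integral_min_recip_le hL
  rw [Real.log_mul hN0.ne' hl0.ne', ← hl] at hint
  set m₁ := unitMeasure.real {x | ε * (N * l) ≤
    birkhoffSum (rotationMap rothAngle) F N x - (1 - ε * η / 4) * (N * l)} with hm₁
  -- With κ = εη/4, the constant 1, the term log l and the deficit in the lower bound are each at
  -- most κl; Markov's inequality divides 3κ by ε.
  have hbig : m₁ ≤ 3 * η / 4 := by
    have h5 : (N : ℝ) * ∫ x, F x ∂unitMeasure ≤ N * (1 + (l + ε * η / 4 * l)) := by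
      gcongr
      exact hint.trans (by linarith)
    have h6 : (N : ℝ) * 1 ≤ N * (ε * η / 4 * l) := by gcongr; linarith
    have h7 : ε * (N * l) * m₁ ≤ ε * (N * l) * (3 * η / 4) := by linarith
    exact le_of_mul_le_mul_left h7 (by positivity)
  have hsmall := unitMeasure_exists_recip_gt_le rothAngle hL N
  have hsmall' : (N : ℝ) / (N * l) ≤ η / 4 := by
    rw [div_le_iff₀ hL0]
    nlinarith
  calc unitMeasure.real {x | (1 + ε) * (N * l) ≤ birkhoffSum (rotationMap rothAngle) recip N x}
      ≤ unitMeasure.real ({x | ∃ n < N, N * l < recip ((rotationMap rothAngle)^[n] x)} ∪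
          {x | ε * (N * l) ≤
            birkhoffSum (rotationMap rothAngle) F N x - (1 - ε * η / 4) * (N * l)}) := by
        refine measureReal_mono fun x hx => ?_
        by_cases hex : ∃ n < N, N * l < recip ((rotationMap rothAngle)^[n] x)
        · exact Or.inl hex
        · push Not at hex
          have heq : birkhoffSum (rotationMap rothAngle) F N x =
              birkhoffSum (rotationMap rothAngle) recip N x :=
            Finset.sum_congr rfl fun n hn => min_eq_left (hex n (Finset.mem_range.mp hn))
          refine Or.inr ?_
          have hx' : (1 + ε) * (N * l) ≤ birkhoffSum (rotationMap rothAngle) recip N x := hx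
          have : 0 ≤ ε * η / 4 * (N * l) := by positivity
          simp only [Set.mem_ofPred_eq, heq]
          linarith
    _ ≤ _ := measureReal_union_le _ _
    _ ≤ η := by linarith

/-- The weak law for the trimmed sums, with the normalization `N log N`. -/
lemma tendsto_measure_trimmedSum (K : ℕ) {ε : ℝ} (hε : 0 < ε) :
    Tendsto (fun N : ℕ => unitMeasure {x : ℝ | ε ≤
      |trimmedSum (rotationMap rothAngle) recip K N x / ((N : ℝ) * Real.log N) - 1|})
      atTop (𝓝 0) := by
  rw [← ENNReal.tendsto_toReal_iff (fun _ => measure_ne_top _ _) ENNReal.zero_ne_top,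
    ENNReal.toReal_zero]
  refine (tendsto_order.2 ⟨fun a ha => Eventually.of_forall fun N =>
    ha.trans_le ENNReal.toReal_nonneg, fun a ha => ?_⟩)
  filter_upwards [eventually_measure_birkhoffSum_ge_le hε (half_pos ha),
    eventually_le_trimmedSum K (half_pos hε), eventually_ge_atTop 2] with N h1 h2 hN
  refine lt_of_le_of_lt ?_ (half_lt_self ha)
  refine le_trans (ENNReal.toReal_mono (measure_ne_top _ _) (measure_mono_ae ?_)) h1
  filter_upwards [ae_mem_Ico_unitMeasure, ae_avoidsZero rothAngle] with x hx hx0 hmem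
  have hN' : (2 : ℝ) ≤ N := by exact_mod_cast hN
  have hlog : 0 < Real.log N := Real.log_pos (by linarith)
  have hd : 0 < N * Real.log N := by positivity
  have h3 := h2 x hx hx0
  have h4 : trimmedSum (rotationMap rothAngle) recip K N x ≤ _ :=
    trimmedSum_le _ _ K N fun n => recip_nonneg_of_nonneg (rotationMap_iterate_mem hx _ n).1
  have hmem' : ε ≤ |trimmedSum (rotationMap rothAngle) recip K N x / (N * Real.log N) - 1| := hmem
  rw [← le_div_iff₀ hd] at h3
  rcases le_abs'.mp hmem' with h | h
  · linarith
  · have h5 : 1 + ε ≤ trimmedSum (rotationMap rothAngle) recip K N x / (N * Real.log N) := by linarith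
    rw [le_div_iff₀ hd] at h5
    exact h5.trans h4

lemma tendstoInMeasure_trimmedSum (K : ℕ) :
    TendstoInMeasure unitMeasure (fun (N : ℕ) x =>
      trimmedSum (rotationMap rothAngle) recip K N x / ((N : ℝ) * Real.log N)) atTop
      fun _ => (1 : ℝ) := by
  rw [tendstoInMeasure_iff_dist]
  exact fun ε hε => tendsto_measure_trimmedSum K hε

/-! ### Oscillation and failure of strong laws. -/

/-- Almost every orbit has large trimmed sums at infinitely many times. -/
lemma ae_frequently_le_trimmedSum (K : ℕ) : ∀ᵐ x ∂unitMeasure, ∃ᶠ N : ℕ in atTop,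
    3 / 2 ≤ trimmedSum (rotationMap rothAngle) recip K N x / ((N : ℝ) * Real.log N) := by
  filter_upwards [ae_mem_Ico_unitMeasure, ae_avoidsZero rothAngle, ae_frequently_fract_lt]
    with x hx hx0 hfr
  rw [frequently_atTop]
  intro N₀
  obtain ⟨n, hn1, ⟨N, hN, hlarge⟩, hn2⟩ :=
    (hfr.and_eventually ((eventually_exists_le_trimmedSum K).and
      (eventually_ge_atTop (max N₀ 2)))).exists
  have hN0 : N₀ ≤ N := (le_max_left _ _).trans (hn2.trans hN)
  have hN2 : 2 ≤ N := (le_max_right _ _).trans (hn2.trans hN)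
  have hN' : (2 : ℝ) ≤ N := by exact_mod_cast hN2
  have hlog : 0 < Real.log N := Real.log_pos (by linarith)
  exact ⟨N, hN0, (le_div_iff₀ (by positivity)).mpr (hlarge x hx hx0 hn1)⟩

/-- A strong law with d_N together with the weak law would force d_N ~ N log N, making the trimmed
sums asymptotic to N log N almost everywhere, against their exceeding 3/2 of it infinitely often. -/
lemma not_ae_tendsto_trimmedSum_div (K : ℕ) (d : ℕ → ℝ) :
    ¬∀ᵐ x ∂unitMeasure,
      Tendsto (fun N : ℕ => trimmedSum (rotationMap rothAngle) recip K N x / d N) atTop (𝓝 1) := by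
  intro h
  have hd : Tendsto (fun N : ℕ => d N / ((N : ℝ) * Real.log N)) atTop (𝓝 1) := by
    -- Along any subsequence, convergence in measure gives a further a.e. convergent one; a single
    -- good x then determines the deterministic limit.
    refine tendsto_of_subseq_tendsto fun ns hns => ?_
    obtain ⟨ms, hmono, hms⟩ := ((tendstoInMeasure_trimmedSum K).comp hns).exists_seq_tendsto_ae
    obtain ⟨x, hx1, hx2⟩ := (h.and hms).exists
    refine ⟨ms, ?_⟩
    have hx3 := hx1.comp (hns.comp hmono.tendsto_atTop)
    have hx4 := hx2.div hx3 one_ne_zero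
    rw [div_one] at hx4
    refine hx4.congr' ?_
    filter_upwards [hx3.eventually_ne one_ne_zero] with i hi
    simp only [Function.comp, ne_eq, div_eq_zero_iff, not_or] at hi
    exact div_div_div_cancel_left' _ _ hi.1
  obtain ⟨x, hx1, hx2⟩ := (h.and (ae_frequently_le_trimmedSum K)).exists
  have h1 := hx1.mul hd
  rw [one_mul] at h1
  have h2 : ∀ᶠ N : ℕ in atTop,
      trimmedSum (rotationMap rothAngle) recip K N x / ((N : ℝ) * Real.log N) < 3 / 2 := by
    filter_upwards [h1.eventually (eventually_lt_nhds (show (1 : ℝ) < 3 / 2 by norm_num)),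
      hd.eventually_ne one_ne_zero] with N hN hdN
    have hd0 : d N ≠ 0 := fun h0 => hdN (by rw [h0, zero_div])
    rwa [div_mul_div_cancel₀ hd0] at hN
  exact hx2 (h2.mono fun N hN => not_le.mpr hN)

theorem mainTheorem6 :
    ∃ α : ℝ, α ∈ Set.Ioo (0 : ℝ) 1 ∧ Irrational α ∧ IsRothType α ∧
      -- the untrimmed weak law with `d_N = N log N`
      (∀ ε : ℝ, 0 < ε →
        Tendsto (fun N : ℕ => unitMeasure
            {x : ℝ | ε < |birkhoffSum (rotationMap α) recip N x / ((N : ℝ) * Real.log N) - 1|})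
          atTop (𝓝 0)) ∧
      -- oscillation of the lightly trimmed sums
      (∀ K : ℕ, 1 ≤ K → ∀ᵐ x ∂unitMeasure,
        1 < limsup (fun N : ℕ => ((trimmedSum (rotationMap α) recip K N x /
              ((N : ℝ) * Real.log N) : ℝ) : EReal)) atTop ∧
        liminf (fun N : ℕ => ((trimmedSum (rotationMap α) recip K N x /
              ((N : ℝ) * Real.log N) : ℝ) : EReal)) atTop ≤ 1) ∧
      -- no trimmed strong law with a constant trimming sequence, whatever the normalization
      (∀ K : ℕ, ∀ d : ℕ → ℝ, (∀ N : ℕ, 1 ≤ N → 0 < d N) →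
        ¬ ∀ᵐ x ∂unitMeasure,
          Tendsto (fun N : ℕ => trimmedSum (rotationMap α) recip K N x / d N) atTop (𝓝 1)) := by
  refine ⟨rothAngle, rothAngle_mem_Ioo, irrational_rothAngle, isRothType_rothAngle, ?_, ?_,
    fun K d _ => not_ae_tendsto_trimmedSum_div K d⟩
  · intro ε hε
    have h := tendsto_measure_trimmedSum 0 hε
    simp only [trimmedSum_zero] at h
    exact tendsto_of_tendsto_of_tendsto_of_le_of_le tendsto_const_nhds h (fun _ => zero_le)
      fun N => measure_mono fun x hx => by
        simp only [Set.mem_ofPred_eq] at hx ⊢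
        exact hx.le
  · intro K _
    -- An a.e. convergent subsequence of the weak law has limit 1, which bounds the liminf.
    obtain ⟨ns, hns, hae⟩ := (tendstoInMeasure_trimmedSum K).exists_seq_tendsto_ae
    filter_upwards [ae_frequently_le_trimmedSum K, hae] with x hx1 hx2
    constructor
    · refine lt_of_lt_of_le (b := ((3 / 2 : ℝ) : EReal)) ?_
        (le_limsup_of_frequently_le (hx1.mono fun N hN => EReal.coe_le_coe_iff.mpr hN))
      exact_mod_cast (by norm_num : (1 : ℝ) < 3 / 2)
    · have h1 : Tendsto (fun i => ((trimmedSum (rotationMap rothAngle) recip K (ns i) x /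
          ((ns i : ℝ) * Real.log (ns i)) : ℝ) : EReal)) atTop (𝓝 ((1 : ℝ) : EReal)) :=
        EReal.tendsto_coe.mpr hx2
      rw [← EReal.coe_one, ← h1.liminf_eq]
      exact liminf_le_liminf_of_le hns.tendsto_atTop
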